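/- Let $k$ be a field and let $H$ be a commutative Hopf algebra over $k$, with comultiplication $\Delta(h)=h_1\otimes h_2$ and antipode $S$ (Sweedler notation; unadorned $\otimes$ is over $k$). A (left-right) Yetter–Drinfeld module is a left $H$-module $M$ which is also a right $H$-comodule, with coaction $m\mapsto m_0\otimes m_1\in M\otimes H$, such that $$h_1m_0\otimes h_2m_1=(h_2m)_0\otimes (h_2m)_1h_1\qquad (h\in H,\ m\in M).$$ With the $H$-linear $H$-colinear maps as morphisms, the Yetter–Drinfeld modules form a $k$-linear abelian category ${}_H\mathcal{YD}^H$ with enough injectives. Write ${}_H\mathrm{Hom}^H(M,P)$ for its spaces of morphisms and, for $i\ge 0$, write ${}_H\mathrm{Ext}^{H,i}(M,-)$ for the $i$-th right derived functor of the left exact functor ${}_H\mathrm{Hom}^H(M,-)$ from ${}_H\mathcal{YD}^H$ to $k$-modules. Let $M,N,P$ be Yetter–Drinfeld modules with $N$ finitely generated projective as an $H$-module. Regard $M\otimes_HN$ as a Yetter–Drinfeld module with the action $h(m\otimes n)=hm\otimes n=m\otimes hn$ and the coaction $m\otimes n\mapsto m_0\otimes n_0\otimes n_1m_1$. Regard the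 space ${}_H\mathrm{Hom}(N,P)$ of $H$-linear maps as a Yetter–Drinfeld module with the action $(hf)(n)=hf(n)$ and the coaction $f\mapsto f_0\otimes f_1\in{}_H\mathrm{Hom}(N,P)\otimes H$ determined by $f_0(n)\otimes f_1=f(n_0)_0\otimes f(n_0)_1S(n_1)$ for all $n\in N$. Then for every $i\ge 0$ there is an isomorphism of $k$-modules $${}_H\mathrm{Ext}^{H,i}\bigl(M,{}_H\mathrm{Hom}(N,P)\bigr)\;\cong\;{}_H\mathrm{Ext}^{H,i}\bigl(M\otimes_HN,\,P\bigr).$$ -/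

import Mathlib

open CategoryTheory CategoryTheory.Limits TensorProduct

universe u

/-- A left-right Yetter-Drinfeld module over a commutative Hopf algebra `H` over a field `k`:
a left `H`-module which is a right `H`-comodule through `coact`, with
`h₁ m₀ ⊗ h₂ m₁ = (h₂ m)₀ ⊗ (h₂ m)₁ h₁` for all `h` in `H` and `m` in the module. -/
structure YDModule (k H : Type u) [Field k] [CommRing H] [HopfAlgebra k H] where
  /-- the underlying type -/
  carrier : Type u
  [addCommGroup : AddCommGroup carrier]
  [moduleBase : Module k carrier]
  [module : Module H carrier]
  [isScalarTower : IsScalarTower k H carrier]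
  /-- the coaction `m ↦ m₀ ⊗ m₁` -/
  coact : carrier →ₗ[k] carrier ⊗[k] H
  coassoc : TensorProduct.assoc k carrier H H ∘ₗ coact.rTensor H ∘ₗ coact =
    (Coalgebra.comul (R := k) (A := H)).lTensor carrier ∘ₗ coact
  counit : TensorProduct.rid k carrier ∘ₗ
    (Coalgebra.counit (R := k) (A := H)).lTensor carrier ∘ₗ coact = LinearMap.id
  compat : ∀ (h : H) (m : carrier),
    -- the bilinear map `(a ⊗ b, n ⊗ c) ↦ a n ⊗ b c` at `(h₁ ⊗ h₂, m₀ ⊗ m₁)`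
    TensorProduct.map₂ (Algebra.lsmul k k carrier).toLinearMap (LinearMap.mul k H)
        (Coalgebra.comul (R := k) h) (coact m) =
      -- the bilinear map `(a, b) ↦ (b m)₀ ⊗ (b m)₁ a` at `h₁ ⊗ h₂`
      TensorProduct.lift ((LinearMap.lTensorHom carrier ∘ₗ (LinearMap.mul k H).flip).compl₂
        (coact ∘ₗ (Algebra.lsmul k k carrier).toLinearMap.flip m)) (Coalgebra.comul (R := k) h)

attribute [instance] YDModule.addCommGroup YDModule.moduleBase YDModule.module
  YDModule.isScalarTower

namespace YDModule

noncomputable section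

instance {k H : Type u} [Field k] [CommRing H] [HopfAlgebra k H] :
    CoeSort (YDModule k H) (Type u) := ⟨carrier⟩

section Hopf

variable {k H : Type u} [Field k] [CommRing H] [HopfAlgebra k H]

section act

variable {X : Type*} [AddCommGroup X] [Module k X] [Module H X] [IsScalarTower k H X]
variable {B : Type*} [CommRing B] [Algebra k B]

/-- The action of `H ⊗ B` on `X ⊗ B`, `(a ⊗ b) (x ⊗ c) = a x ⊗ b c`. -/
def act (X : Type*) [AddCommGroup X] [Module k X] [Module H X] [IsScalarTower k H X]
    (B : Type*) [CommRing B] [Algebra k B] : H ⊗[k] B →ₐ[k] Module.End k (X ⊗[k] B) :=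
  Module.endTensorEndAlgHom.comp
    (Algebra.TensorProduct.map (Algebra.lsmul k k X) (Algebra.lsmul k k B))

@[simp] theorem act_tmul (a : H) (b : B) (x : X) (c : B) :
    act X B (a ⊗ₜ[k] b) (x ⊗ₜ c) = (a • x) ⊗ₜ (b * c) := rfl

theorem act_map {B' : Type*} [CommRing B'] [Algebra k B'] (f : B →ₐ[k] B') (t : H ⊗[k] B)
    (x : X ⊗[k] B) : f.toLinearMap.lTensor X (act X B t x) =
      act X B' (Algebra.TensorProduct.map (AlgHom.id k H) f t) (f.toLinearMap.lTensor X x) := by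
  induction t with
  | zero => simp
  | add a b ha hb => simp [ha, hb]
  | tmul a b =>
    induction x with
    | zero => simp
    | add x y hx hy => simp only [map_add, hx, hy]
    | tmul x c => simp

end act

theorem comp_mul {C D : Type*} [CommRing C] [CommRing D] [Algebra k C] [Algebra k D]
    (h : C →ₐ[k] D) (f g : WithConv (H →ₐ[k] C)) :
    WithConv.toConv (h.comp (f * g).ofConv) =
      WithConv.toConv (h.comp f.ofConv) * WithConv.toConv (h.comp g.ofConv) := by
  rw [AlgHom.comp_convMul_distrib]

/-- The convolution group of algebra maps from `H` to a commutative algebra. -/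
@[reducible] def algHomGroup {C : Type*} [CommRing C] [Algebra k C] :
    Group (WithConv (H →ₐ[k] C)) :=
  { (inferInstance : Monoid (WithConv (H →ₐ[k] C))) with
    inv := fun f => WithConv.toConv (f.ofConv.comp (HopfAlgebra.antipodeAlgHom k H))
    inv_mul_cancel := fun f => by
      change WithConv.toConv (f.ofConv.comp (HopfAlgebra.antipodeAlgHom k H)) * f = 1
      have := comp_mul f.ofConv (WithConv.toConv (HopfAlgebra.antipodeAlgHom k H))
        (WithConv.toConv (AlgHom.id k H))
      rw [AlgHom.antipode_id_cancel] at this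
      refine this.symm.trans ?_
      ext c
      simp [AlgHom.convOne_def] }

attribute [local instance] algHomGroup

/-- The algebra map `h ↦ h₂ ⊗ h₃ S(h₁)`. -/
def ad (k H : Type u) [Field k] [CommRing H] [HopfAlgebra k H] :
    H →ₐ[k] H ⊗[k] H :=
  ((WithConv.toConv (Algebra.TensorProduct.includeRight : H →ₐ[k] H ⊗[k] H))⁻¹ *
    WithConv.toConv (Algebra.TensorProduct.includeLeft : H →ₐ[k] H ⊗[k] H) *
    WithConv.toConv (Algebra.TensorProduct.includeRight : H →ₐ[k] H ⊗[k] H)).ofConv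

theorem comp_inv {C D : Type*} [CommRing C] [CommRing D] [Algebra k C] [Algebra k D]
    (h : C →ₐ[k] D) (f : WithConv (H →ₐ[k] C)) :
    WithConv.toConv (h.comp (f⁻¹).ofConv) = (WithConv.toConv (h.comp f.ofConv))⁻¹ := rfl

theorem comp_antipode {C : Type*} [CommRing C] [Algebra k C] (f : H →ₐ[k] C) :
    WithConv.toConv (f.comp (HopfAlgebra.antipodeAlgHom k H)) = (WithConv.toConv f)⁻¹ := rfl

theorem toConv_comul : WithConv.toConv (Bialgebra.comulAlgHom k H) =
    WithConv.toConv (Algebra.TensorProduct.includeLeft : H →ₐ[k] H ⊗[k] H) *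
    WithConv.toConv (Algebra.TensorProduct.includeRight : H →ₐ[k] H ⊗[k] H) := by
  have : ∀ c : H ⊗[k] H, Algebra.TensorProduct.lift
      (Algebra.TensorProduct.includeLeft : H →ₐ[k] H ⊗[k] H)
      (Algebra.TensorProduct.includeRight : H →ₐ[k] H ⊗[k] H) (fun _ _ ↦ .all ..) c = c := by
    intro c
    induction c with
    | zero => simp
    | add a b ha hb => rw [map_add, ha, hb]
    | tmul a b => simp
  ext c
  exact ((AlgHom.convMul_apply _ _ _).trans (this _)).symm

theorem toConv_ad : WithConv.toConv (ad k H) =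
  (WithConv.toConv (Algebra.TensorProduct.includeRight : H →ₐ[k] H ⊗[k] H))⁻¹ *
    WithConv.toConv (Algebra.TensorProduct.includeLeft : H →ₐ[k] H ⊗[k] H) *
    WithConv.toConv (Algebra.TensorProduct.includeRight : H →ₐ[k] H ⊗[k] H) := rfl

theorem comp_ad {C : Type*} [CommRing C] [Algebra k C] (f : H ⊗[k] H →ₐ[k] C) :
    WithConv.toConv (f.comp (ad k H)) =
     (WithConv.toConv (f.comp (Algebra.TensorProduct.includeRight : H →ₐ[k] H ⊗[k] H)))⁻¹ *
    WithConv.toConv (f.comp (Algebra.TensorProduct.includeLeft : H →ₐ[k] H ⊗[k] H)) *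
    WithConv.toConv (f.comp (Algebra.TensorProduct.includeRight : H →ₐ[k] H ⊗[k] H)) := by
  rw [ad, comp_mul, comp_mul, comp_inv]

theorem ad_counit : (Algebra.TensorProduct.map (AlgHom.id k H) (Bialgebra.counitAlgHom k H)).comp
    (ad k H) = Algebra.TensorProduct.includeLeft := by
  apply WithConv.toConv_injective
  have h : WithConv.toConv ((Algebra.TensorProduct.map (AlgHom.id k H)
      (Bialgebra.counitAlgHom k H)).comp
      (Algebra.TensorProduct.includeRight : H →ₐ[k] H ⊗[k] H)) = 1 := by
    ext c
    rw [AlgHom.convOne_apply, Algebra.algebraMap_eq_smul_one]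
    change (1 : H) ⊗ₜ[k] Coalgebra.counit (R := k) c = _
    rw [Algebra.TensorProduct.one_def, ← TensorProduct.tmul_smul]
    simp
  rw [comp_ad, h, inv_one, one_mul, mul_one]
  congr 1
  ext c
  simp

theorem conj_aux {G : Type*} [Group G] (a b c : G) :
    a⁻¹ * (b⁻¹ * c * b) * a = (b * a)⁻¹ * c * (b * a) := by
  group

theorem conj_aux' {G : Type*} [Group G] (a b : G) : b * a = a * (a⁻¹ * b * a) := by
  group

theorem ad_coassoc :
    (Algebra.TensorProduct.assoc k k k H H H).toAlgHom.comp
      ((Algebra.TensorProduct.map (ad k H) (AlgHom.id k H)).comp (ad k H)) =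
    (Algebra.TensorProduct.map (AlgHom.id k H) (Bialgebra.comulAlgHom k H)).comp (ad k H) := by
  apply WithConv.toConv_injective
  rw [← AlgHom.comp_assoc, comp_ad, comp_ad]
  have e1 : (Algebra.TensorProduct.map (AlgHom.id k H) (Bialgebra.comulAlgHom k H)).comp
      Algebra.TensorProduct.includeRight =
      (Algebra.TensorProduct.includeRight : H ⊗[k] H →ₐ[k] H ⊗[k] (H ⊗[k] H)).comp
      (Bialgebra.comulAlgHom k H) := by
    ext; simp
  have e2 : ((Algebra.TensorProduct.assoc k k k H H H).toAlgHom.comp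
      (Algebra.TensorProduct.map (ad k H) (AlgHom.id k H))).comp
      Algebra.TensorProduct.includeLeft =
      ((Algebra.TensorProduct.assoc k k k H H H).toAlgHom.comp
      Algebra.TensorProduct.includeLeft).comp (ad k H) := by
    ext; simp
  rw [e1, e2, comp_ad]
  have e3 : WithConv.toConv ((Algebra.TensorProduct.includeRight :
      H ⊗[k] H →ₐ[k] H ⊗[k] (H ⊗[k] H)).comp (Bialgebra.comulAlgHom k H)) =
      WithConv.toConv ((Algebra.TensorProduct.includeRight :
      H ⊗[k] H →ₐ[k] H ⊗[k] (H ⊗[k] H)).comp Algebra.TensorProduct.includeLeft) *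
      WithConv.toConv ((Algebra.TensorProduct.includeRight :
      H ⊗[k] H →ₐ[k] H ⊗[k] (H ⊗[k] H)).comp Algebra.TensorProduct.includeRight) := by
    rw [← WithConv.ofConv_toConv (Bialgebra.comulAlgHom k H), toConv_comul, comp_mul]
  have e4 : ((Algebra.TensorProduct.assoc k k k H H H).toAlgHom.comp
      (Algebra.TensorProduct.map (ad k H) (AlgHom.id k H))).comp
      Algebra.TensorProduct.includeRight = (Algebra.TensorProduct.includeRight :
      H ⊗[k] H →ₐ[k] H ⊗[k] (H ⊗[k] H)).comp Algebra.TensorProduct.includeRight := by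
    ext; simp [Algebra.TensorProduct.one_def]
  have e5 : ((Algebra.TensorProduct.assoc k k k H H H).toAlgHom.comp
      Algebra.TensorProduct.includeLeft).comp Algebra.TensorProduct.includeRight =
      (Algebra.TensorProduct.includeRight :
      H ⊗[k] H →ₐ[k] H ⊗[k] (H ⊗[k] H)).comp Algebra.TensorProduct.includeLeft := by
    ext; simp
  have e6 : ((Algebra.TensorProduct.assoc k k k H H H).toAlgHom.comp
      Algebra.TensorProduct.includeLeft).comp Algebra.TensorProduct.includeLeft =
      (Algebra.TensorProduct.map (AlgHom.id k H) (Bialgebra.comulAlgHom k H)).comp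
      Algebra.TensorProduct.includeLeft := by
    ext; simp [Algebra.TensorProduct.one_def]
  rw [e3, e4, e5, e6]
  exact conj_aux _ _ _

/-- The algebra map `a ⊗ b ↦ ad(a) (1 ⊗ S(b))`. -/
def unad (k H : Type u) [Field k] [CommRing H] [HopfAlgebra k H] :
    H ⊗[k] H →ₐ[k] H ⊗[k] H :=
  Algebra.TensorProduct.lift (ad k H)
    (Algebra.TensorProduct.includeRight.comp (HopfAlgebra.antipodeAlgHom k H))
    (fun _ _ ↦ .all ..)

theorem unad_ad (h : H) : unad k H (ad k H h) = h ⊗ₜ 1 := by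
  have : (unad k H).comp (ad k H) = Algebra.TensorProduct.includeLeft := by
    apply WithConv.toConv_injective
    have h1 : (unad k H).comp Algebra.TensorProduct.includeLeft = ad k H := by
      ext; simp [unad]
    have h2 : (unad k H).comp Algebra.TensorProduct.includeRight =
      Algebra.TensorProduct.includeRight.comp (HopfAlgebra.antipodeAlgHom k H) := by
      ext; simp [unad]
    rw [comp_ad, h1, h2, comp_antipode, toConv_ad]
    group
  exact congr($this h)

theorem comul_antipode (h : H) : Coalgebra.comul (R := k) (HopfAlgebra.antipode k h : H) =
   (TensorProduct.comm k H H) (TensorProduct.map (HopfAlgebra.antipode k) (HopfAlgebra.antipode k)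
     (Coalgebra.comul (R := k) h)) := by
  have : (Bialgebra.comulAlgHom k H).comp (HopfAlgebra.antipodeAlgHom k H) =
    ((Algebra.TensorProduct.comm k H H).toAlgHom.comp
      (Algebra.TensorProduct.map (HopfAlgebra.antipodeAlgHom k H)
       (HopfAlgebra.antipodeAlgHom k H))).comp (Bialgebra.comulAlgHom k H) := by
    apply WithConv.toConv_injective
    rw [comp_antipode, toConv_comul, ← WithConv.ofConv_toConv (Bialgebra.comulAlgHom k H),
      toConv_comul, comp_mul, mul_inv_rev]
    congr 1
    · rw [← comp_antipode]; congr 1; ext; simp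
    · rw [← comp_antipode]; congr 1; ext; simp
  exact congr($this h)

end Hopf

variable {k H : Type u} [Field k] [CommRing H] [HopfAlgebra k H]

section convAct

variable {A X : Type*} [CommRing A] [Algebra k A] [AddCommGroup X] [Module k X]

/-- `h ↦ c(h₁) r(h₂)`. -/
def convAct (α : A →ₐ[k] Module.End k X) (c : H →ₗ[k] A) (r : H →ₗ[k] X) : H →ₗ[k] X :=
  TensorProduct.lift ((α.toLinearMap ∘ₗ c).compl₂ r) ∘ₗ Coalgebra.comul (R := k)

theorem convAct_mul (α : A →ₐ[k] Module.End k X) (c d : WithConv (H →ₐ[k] A)) (r : H →ₗ[k] X) :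
    convAct α (c * d).ofConv.toLinearMap r =
      convAct α c.ofConv.toLinearMap (convAct α d.ofConv.toLinearMap r) := by
  let Φ : H ⊗[k] (H ⊗[k] H) →ₗ[k] X :=
    TensorProduct.lift ((α.toLinearMap ∘ₗ c.ofConv.toLinearMap).compl₂
      (TensorProduct.lift ((α.toLinearMap ∘ₗ d.ofConv.toLinearMap).compl₂ r)))
  ext h
  have h1 : ∀ t : H ⊗[k] H, TensorProduct.lift
      ((α.toLinearMap ∘ₗ (c * d).ofConv.toLinearMap).compl₂ r) t =
      Φ (TensorProduct.assoc k H H H ((Coalgebra.comul (R := k)).rTensor H t)) := by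
    intro t
    induction t with
    | zero => simp
    | add a b ha hb => simp only [map_add, ha, hb]
    | tmul a b =>
      have h2 : ∀ s : H ⊗[k] H, α (Algebra.TensorProduct.lift c.ofConv d.ofConv
          (fun _ _ ↦ .all ..) s) (r b) = Φ (TensorProduct.assoc k H H H (s ⊗ₜ b)) := by
        intro s
        induction s with
        | zero => simp
        | add a b ha hb => simp only [map_add, ha, hb, add_tmul, LinearMap.add_apply]
        | tmul a c => simp [Φ]
      simp only [lift.tmul, LinearMap.rTensor_tmul, ← h2]
      exact congr(α $(AlgHom.convMul_apply c d a) (r b))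
  have h3 : ∀ t : H ⊗[k] H, TensorProduct.lift
      ((α.toLinearMap ∘ₗ c.ofConv.toLinearMap).compl₂ (convAct α d.ofConv.toLinearMap r)) t =
      Φ ((Coalgebra.comul (R := k)).lTensor H t) := by
    intro t
    induction t with
    | zero => simp
    | add a b ha hb => simp only [map_add, ha, hb]
    | tmul a b => simp [Φ, convAct]
  change TensorProduct.lift _ (Coalgebra.comul (R := k) h) =
    TensorProduct.lift _ (Coalgebra.comul (R := k) h)
  rw [h1, h3, Coalgebra.coassoc_apply]

theorem convAct_one (α : A →ₐ[k] Module.End k X) (r : H →ₗ[k] X) :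
    convAct α (1 : WithConv (H →ₐ[k] A)).ofConv.toLinearMap r = r := by
  ext h
  have h1 : ∀ t : H ⊗[k] H, TensorProduct.lift
      ((α.toLinearMap ∘ₗ (1 : WithConv (H →ₐ[k] A)).ofConv.toLinearMap).compl₂ r) t =
      r (TensorProduct.lid k H ((Coalgebra.counit (R := k)).rTensor H t)) := by
    intro t
    induction t with
    | zero => simp
    | add a b ha hb => simp only [map_add, ha, hb]
    | tmul a b => simp [AlgHom.convOne_def, Algebra.ofId_apply]
  change TensorProduct.lift _ (Coalgebra.comul (R := k) h) = _
  rw [h1]; simp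

theorem convAct_apply_orbit (α : A →ₐ[k] Module.End k X) (c d : WithConv (H →ₐ[k] A)) (x : X) :
    convAct α c.ofConv.toLinearMap
      ((α.toLinearMap ∘ₗ d.ofConv.toLinearMap).flip x) =
      (α.toLinearMap ∘ₗ (c * d).ofConv.toLinearMap).flip x := by
  ext h
  have h1 : ∀ t : H ⊗[k] H, TensorProduct.lift
      ((α.toLinearMap ∘ₗ c.ofConv.toLinearMap).compl₂
       ((α.toLinearMap ∘ₗ d.ofConv.toLinearMap).flip x)) t =
      α (Algebra.TensorProduct.lift c.ofConv d.ofConv (fun _ _ ↦ .all ..) t) x := by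
    intro t
    induction t with
    | zero => simp
    | add a b ha hb => simp only [map_add, ha, hb, LinearMap.add_apply]
    | tmul a b => simp
  change TensorProduct.lift _ (Coalgebra.comul (R := k) h) = _
  rw [h1]
  simp only [LinearMap.flip_apply, LinearMap.comp_apply]
  change _ = α ((c * d) h) x
  exact congr(α $((AlgHom.convMul_apply c d h).symm) x)

end convAct

/-- The Yetter-Drinfeld compatibility in the form `ρ(h m) = h₂ m₀ ⊗ h₃ m₁ S(h₁)`. -/
theorem compat_iff {X : Type*} [AddCommGroup X] [Module k X] [Module H X] [IsScalarTower k H X]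
    (ρ : X →ₗ[k] X ⊗[k] H) (m : X) :
    (∀ h : H, TensorProduct.map₂ (Algebra.lsmul k k X).toLinearMap (LinearMap.mul k H)
        (Coalgebra.comul (R := k) h) (ρ m) =
      TensorProduct.lift ((LinearMap.lTensorHom X ∘ₗ (LinearMap.mul k H).flip).compl₂
        (ρ ∘ₗ (Algebra.lsmul k k X).toLinearMap.flip m)) (Coalgebra.comul (R := k) h)) ↔
    ∀ h : H, ρ (h • m) = act X H (ad k H h) (ρ m) := by
  let i₂ := WithConv.toConv (Algebra.TensorProduct.includeRight : H →ₐ[k] H ⊗[k] H)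
  let Δ := WithConv.toConv (Bialgebra.comulAlgHom k H)
  let r : H →ₗ[k] X ⊗[k] H := ρ ∘ₗ (Algebra.lsmul k k X).toLinearMap.flip m
  let o (c : WithConv (H →ₐ[k] H ⊗[k] H)) : H →ₗ[k] X ⊗[k] H :=
    ((act X H).toLinearMap ∘ₗ c.ofConv.toLinearMap).flip (ρ m)
  have hl : ∀ h : H, TensorProduct.map₂ (Algebra.lsmul k k X).toLinearMap (LinearMap.mul k H)
        (Coalgebra.comul (R := k) h) (ρ m) = o Δ h := by
    intro h
    change _ = act X H (Coalgebra.comul (R := k) h) (ρ m)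
    have : ∀ (t : H ⊗[k] H) (x : X ⊗[k] H), TensorProduct.map₂ (Algebra.lsmul k k X).toLinearMap (LinearMap.mul k H)
        t x = act X H t x := by
      intro t x
      induction t with
      | zero => simp
      | add a b ha hb => simp [ha, hb]
      | tmul a b =>
        induction x with
        | zero => simp
        | add x y hx hy => simp only [map_add, hx, hy]
        | tmul x c => simp
    exact this _ _
  have hr : ∀ h : H, TensorProduct.lift
      ((LinearMap.lTensorHom X ∘ₗ (LinearMap.mul k H).flip).compl₂
        (ρ ∘ₗ (Algebra.lsmul k k X).toLinearMap.flip m)) (Coalgebra.comul (R := k) h) =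
      convAct (act X H) i₂.ofConv.toLinearMap r h := by
    intro h
    have : (LinearMap.lTensorHom X ∘ₗ (LinearMap.mul k H).flip) =
        (act X H).toLinearMap ∘ₗ i₂.ofConv.toLinearMap := by
      ext a x c
      simp [i₂]
    rw [this]
    rfl
  have hΔ : Δ = i₂ * WithConv.toConv (ad k H) := by
    rw [toConv_ad]
    exact toConv_comul.trans (conj_aux' (G := WithConv (H →ₐ[k] H ⊗[k] H)) i₂ _)
  simp only [hl, hr]
  rw [← DFunLike.ext_iff]
  have h1 : (∀ h : H, ρ (h • m) = act X H (ad k H h) (ρ m)) ↔ r = o (WithConv.toConv (ad k H)) :=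
    (DFunLike.ext_iff (f := r) (g := o (WithConv.toConv (ad k H)))).symm
  rw [h1, hΔ]
  simp only [o]
  rw [← convAct_apply_orbit]
  constructor
  · intro h
    have := congrArg (convAct (act X H) (i₂⁻¹).ofConv.toLinearMap) h
    have e : i₂⁻¹ * i₂ = 1 := inv_mul_cancel i₂
    rw [← convAct_mul, ← convAct_mul, e, convAct_one, convAct_one] at this
    exact this.symm
  · intro h
    rw [← h]

theorem coassoc_apply (M : YDModule k H) (m : M) :
    TensorProduct.assoc k M H H (M.coact.rTensor H (M.coact m)) =
      (Coalgebra.comul (R := k) (A := H)).lTensor M (M.coact m) :=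
  congr($M.coassoc m)

theorem counit_apply (M : YDModule k H) (m : M) :
    TensorProduct.rid k M ((Coalgebra.counit (R := k) (A := H)).lTensor M (M.coact m)) = m :=
  congr($M.counit m)

theorem coact_smul (M : YDModule k H) (h : H) (m : M) :
    M.coact (h • m) = act M H (ad k H h) (M.coact m) :=
  (compat_iff M.coact m).1 (fun h => M.compat h m) h

section transport

variable {X Y : Type*} [AddCommGroup X] [Module k X]
  [AddCommGroup Y] [Module k Y]

theorem rTensor_assoc' (ρ : X →ₗ[k] X ⊗[k] H) (f : X →ₗ[k] Y) (y : X ⊗[k] H) :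
    f.rTensor (H ⊗[k] H) (TensorProduct.assoc k X H H (ρ.rTensor H y)) =
      TensorProduct.assoc k Y H H ((f.rTensor H ∘ₗ ρ).rTensor H y) := by
  induction y with
  | zero => simp
  | add a b ha hb => simp only [map_add, ha, hb]
  | tmul x a =>
    simp only [LinearMap.rTensor_tmul, LinearMap.comp_apply]
    generalize ρ x = z
    induction z with
    | zero => simp
    | add a b ha hb => simp only [map_add, add_tmul, ha, hb]
    | tmul x a => simp

theorem rTensor_assoc (ρ : X →ₗ[k] X ⊗[k] H) (σ : Y →ₗ[k] Y ⊗[k] H) (f : X →ₗ[k] Y)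
    (hf : ∀ x, σ (f x) = f.rTensor H (ρ x)) (y : X ⊗[k] H) :
    f.rTensor (H ⊗[k] H) (TensorProduct.assoc k X H H (ρ.rTensor H y)) =
      TensorProduct.assoc k Y H H (σ.rTensor H (f.rTensor H y)) := by
  have h : σ ∘ₗ f = f.rTensor H ∘ₗ ρ := LinearMap.ext hf
  rw [rTensor_assoc', ← LinearMap.rTensor_comp_apply, h]

theorem rTensor_comul (f : X →ₗ[k] Y) (y : X ⊗[k] H) :
    f.rTensor (H ⊗[k] H) ((Coalgebra.comul (R := k) (A := H)).lTensor X y) =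
      (Coalgebra.comul (R := k) (A := H)).lTensor Y (f.rTensor H y) := by
  induction y with
  | zero => simp
  | add a b ha hb => simp only [map_add, ha, hb]
  | tmul x a => simp

theorem rTensor_counit (f : X →ₗ[k] Y) (y : X ⊗[k] H) :
    f (TensorProduct.rid k X ((Coalgebra.counit (R := k) (A := H)).lTensor X y)) =
      TensorProduct.rid k Y ((Coalgebra.counit (R := k) (A := H)).lTensor Y (f.rTensor H y)) := by
  induction y with
  | zero => simp
  | add a b ha hb => simp only [map_add, ha, hb]
  | tmul x a => simp

variable [Module H X] [IsScalarTower k H X] [Module H Y] [IsScalarTower k H Y]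

theorem rTensor_act (f : X →ₗ[H] Y) {B : Type*} [CommRing B] [Algebra k B] (t : H ⊗[k] B)
    (y : X ⊗[k] B) :
    (f.restrictScalars k).rTensor B (act X B t y) =
      act Y B t ((f.restrictScalars k).rTensor B y) := by
  induction t with
  | zero => simp
  | add a b ha hb => simp only [map_add, LinearMap.add_apply, ha, hb]
  | tmul a b =>
    induction y with
    | zero => simp
    | add x y hx hy => simp only [map_add, hx, hy]
    | tmul x c => simp

end transport

section ofMaps

variable (X : Type u) [AddCommGroup X] [Module k X] [Module H X] [IsScalarTower k H X]
  (ρ : X →ₗ[k] X ⊗[k] H)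

/-- A Yetter-Drinfeld structure from one that it embeds into. -/
def ofInjective (M : YDModule k H) (f : X →ₗ[H] M) (hf : Function.Injective f)
    (hρ : ∀ x, M.coact (f x) = (f.restrictScalars k).rTensor H (ρ x)) : YDModule k H where
  carrier := X
  coact := ρ
  coassoc := by
    ext x
    apply Module.Flat.rTensor_preserves_injective_linearMap (M := H ⊗[k] H)
      (f.restrictScalars k) hf
    simp only [LinearMap.comp_apply, LinearEquiv.coe_coe]
    rw [rTensor_assoc ρ M.coact (f.restrictScalars k) hρ, rTensor_comul, ← hρ, coassoc_apply]
  counit := by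
    ext x
    apply hf
    have := rTensor_counit (f.restrictScalars k) (ρ x)
    rw [← hρ, counit_apply] at this
    exact this
  compat := fun h m => (compat_iff ρ m).2 (fun h => by
    apply Module.Flat.rTensor_preserves_injective_linearMap (M := H) (f.restrictScalars k) hf
    rw [rTensor_act, ← hρ, ← hρ, map_smul, coact_smul]) h

/-- A Yetter-Drinfeld structure generated by the images of two others. -/
def ofImages (M N : YDModule k H) (f : M →ₗ[H] X) (g : N →ₗ[H] X)
    (hfg : ∀ x, ∃ m n, x = f m + g n)
    (hf : ∀ x, ρ (f x) = (f.restrictScalars k).rTensor H (M.coact x))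
    (hg : ∀ x, ρ (g x) = (g.restrictScalars k).rTensor H (N.coact x)) : YDModule k H where
  carrier := X
  coact := ρ
  coassoc := by
    ext x
    obtain ⟨m, n, rfl⟩ := hfg x
    simp only [LinearMap.comp_apply, LinearEquiv.coe_coe, map_add, hf, hg]
    rw [← rTensor_assoc M.coact ρ (f.restrictScalars k) hf,
      ← rTensor_assoc N.coact ρ (g.restrictScalars k) hg, coassoc_apply, coassoc_apply,
      rTensor_comul, rTensor_comul]
  counit := by
    ext x
    obtain ⟨m, n, rfl⟩ := hfg x
    simp only [LinearMap.comp_apply, LinearEquiv.coe_coe, map_add, hf, hg, LinearMap.id_apply]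
    rw [← rTensor_counit, ← rTensor_counit, counit_apply, counit_apply]
    rfl
  compat := fun h x => (compat_iff ρ x).2 (fun h => by
    obtain ⟨m, n, rfl⟩ := hfg x
    rw [smul_add, map_add, ← map_smul, ← map_smul, hf, hg, coact_smul, coact_smul, rTensor_act,
      rTensor_act, ← hf, ← hg, map_add, map_add]) h

end ofMaps

section category

/-- Morphisms of Yetter-Drinfeld modules: `H`-linear `H`-colinear maps. -/
@[ext]
structure Hom (M N : YDModule k H) where
  /-- the underlying `H`-linear map -/
  toLin : M →ₗ[H] N
  colin : ∀ m, N.coact (toLin m) = (toLin.restrictScalars k).rTensor H (M.coact m)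

instance : Category (YDModule k H) where
  Hom := Hom
  id M := ⟨LinearMap.id, fun m => by
    change _ = (LinearMap.id : M →ₗ[k] M).rTensor H _
    simp⟩
  comp f g := ⟨g.toLin ∘ₗ f.toLin, fun m => by
    change _ = (g.toLin.restrictScalars k ∘ₗ f.toLin.restrictScalars k).rTensor H _
    rw [LinearMap.rTensor_comp, LinearMap.comp_apply, LinearMap.comp_apply, ← f.colin, ← g.colin]⟩

theorem hom_ext {M N : YDModule k H} {f g : M ⟶ N} (h : ∀ m, f.toLin m = g.toLin m) : f = g :=
  Hom.ext (LinearMap.ext h)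

@[simp] theorem id_toLin (M : YDModule k H) : Hom.toLin (𝟙 M) = LinearMap.id := rfl

@[simp] theorem comp_toLin {M N P : YDModule k H} (f : M ⟶ N) (g : N ⟶ P) :
    (f ≫ g).toLin = g.toLin ∘ₗ f.toLin := rfl

/-- The `H`-colinear maps among the `H`-linear maps. -/
def colinear (M N : YDModule k H) : Submodule k (M →ₗ[H] N) where
  carrier := {f | ∀ m, N.coact (f m) = (f.restrictScalars k).rTensor H (M.coact m)}
  zero_mem' := fun m => by
    rw [LinearMap.restrictScalars_zero, LinearMap.rTensor_zero]; simp
  add_mem' := fun {f g} hf hg m => by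
    rw [LinearMap.restrictScalars_add, LinearMap.rTensor_add, LinearMap.add_apply,
      LinearMap.add_apply, map_add, hf, hg]
  smul_mem' := fun c f hf m => by
    have : (c • f).restrictScalars k = c • f.restrictScalars k := rfl
    rw [this, LinearMap.rTensor_smul, LinearMap.smul_apply, LinearMap.smul_apply, map_smul, hf]

/-- Morphisms as colinear elements of the space of linear maps. -/
def homEquiv (M N : YDModule k H) : (M ⟶ N) ≃ colinear M N where
  toFun f := ⟨f.toLin, f.colin⟩
  invFun f := ⟨f.1, f.2⟩
  left_inv _ := rfl
  right_inv _ := rfl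

instance (M N : YDModule k H) : AddCommGroup (M ⟶ N) := (homEquiv M N).addCommGroup

instance (M N : YDModule k H) : Module k (M ⟶ N) := (homEquiv M N).module k

@[simp] theorem add_toLin {M N : YDModule k H} (f g : M ⟶ N) :
    (f + g).toLin = f.toLin + g.toLin := rfl

@[simp] theorem smul_toLin {M N : YDModule k H} (c : k) (f : M ⟶ N) :
    (c • f).toLin = c • f.toLin := rfl

@[simp] theorem zero_toLin {M N : YDModule k H} : Hom.toLin (0 : M ⟶ N) = 0 := rfl

instance : Preadditive (YDModule k H) where
  add_comp _ _ _ f g h := hom_ext fun m => by simp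
  comp_add _ _ _ f g h := hom_ext fun m => by simp

instance : Linear k (YDModule k H) where
  smul_comp _ _ _ c f g := hom_ext fun m => by
    simp only [comp_toLin, smul_toLin, LinearMap.comp_apply, LinearMap.smul_apply]
    exact map_smul (g.toLin.restrictScalars k) c (f.toLin m)
  comp_smul _ _ _ f c g := hom_ext fun m => by simp

/-- The underlying `H`-module. -/
def forgetH (k H : Type u) [Field k] [CommRing H] [HopfAlgebra k H] :
    YDModule k H ⥤ ModuleCat.{u} H where
  obj M := ModuleCat.of H M
  map f := ModuleCat.ofHom f.toLin

instance : (forgetH k H).Faithful where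
  map_injective h := Hom.ext (congrArg ModuleCat.Hom.hom h)

/-- The zero Yetter-Drinfeld module. -/
def zeroObj (k H : Type u) [Field k] [CommRing H] [HopfAlgebra k H] : YDModule k H where
  carrier := PUnit
  coact := 0
  coassoc := by ext; simp
  counit := by ext
  compat := fun h m => by
    have : Subsingleton (PUnit.{u + 1} ⊗[k] H) := inferInstance
    exact Subsingleton.elim _ _

instance : HasZeroObject (YDModule k H) := ⟨zeroObj k H, by
  rw [IsZero.iff_id_eq_zero]
  exact hom_ext fun m => rfl⟩

/-- The coaction on the direct sum. -/
def prodCoact (M N : YDModule k H) : (M × N) →ₗ[k] (M × N) ⊗[k] H :=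
  LinearMap.coprod (((LinearMap.inl H M N).restrictScalars k).rTensor H ∘ₗ M.coact)
    (((LinearMap.inr H M N).restrictScalars k).rTensor H ∘ₗ N.coact)

theorem prodCoact_inl (M N : YDModule k H) (x : M) : prodCoact M N (LinearMap.inl H M N x) =
    ((LinearMap.inl H M N).restrictScalars k).rTensor H (M.coact x) := by
  simp [prodCoact]

theorem prodCoact_inr (M N : YDModule k H) (x : N) : prodCoact M N (LinearMap.inr H M N x) =
    ((LinearMap.inr H M N).restrictScalars k).rTensor H (N.coact x) := by
  simp [prodCoact]

/-- The direct sum. -/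
def prodObj (M N : YDModule k H) : YDModule k H :=
  ofImages (M × N) (prodCoact M N) M N (LinearMap.inl H M N) (LinearMap.inr H M N)
    (fun x => ⟨x.1, x.2, by simp⟩) (prodCoact_inl M N) (prodCoact_inr M N)

theorem prod_proj {M N L : YDModule k H} (f : M →ₗ[H] L) (g : N →ₗ[H] L)
    (hf : f ∈ colinear M L) (hg : g ∈ colinear N L) (x : M × N) :
    L.coact (f.coprod g x) = ((f.coprod g).restrictScalars k).rTensor H (prodCoact M N x) := by
  simp only [prodCoact, LinearMap.coprod_apply, map_add, hf x.1, hg x.2, LinearMap.comp_apply,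
    ← LinearMap.rTensor_comp_apply]
  congr 3
  · ext; simp
  · ext; simp

instance : HasBinaryBiproducts (YDModule k H) where
  has_binary_biproduct M N := HasBinaryBiproduct.mk
    { bicone :=
        { pt := prodObj M N
          fst := ⟨(LinearMap.id : M →ₗ[H] M).coprod 0,
            prod_proj _ _ (Hom.colin (𝟙 M)) (Submodule.zero_mem _)⟩
          snd := ⟨(0 : M →ₗ[H] N).coprod LinearMap.id,
            prod_proj _ _ (Submodule.zero_mem _) (Hom.colin (𝟙 N))⟩
          inl := ⟨LinearMap.inl H M N, prodCoact_inl M N⟩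
          inr := ⟨LinearMap.inr H M N, prodCoact_inr M N⟩
          inl_fst := hom_ext fun m => add_zero m
          inl_snd := hom_ext fun m => add_zero (0 : N)
          inr_fst := hom_ext fun m => add_zero (0 : M)
          inr_snd := hom_ext fun m => zero_add m }
      isBilimit := isBinaryBilimitOfTotal _ (hom_ext fun m => by
        obtain ⟨a, b⟩ : M × N := m
        change ((a + 0, 0) : M × N) + ((0, 0 + b) : M × N) = (a, b)
        simp) }

instance : HasFiniteProducts (YDModule k H) :=
  haveI : HasTerminal (YDModule k H) := HasZeroObject.hasTerminal
  hasFiniteProducts_of_has_binary_and_terminal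

section ker

variable {M N : YDModule k H} (f : M ⟶ N)

theorem ker_coact (x : LinearMap.ker f.toLin) : M.coact x ∈
    LinearMap.range (((LinearMap.ker f.toLin).subtype.restrictScalars k).rTensor H) := by
  have : Function.Exact (((LinearMap.ker f.toLin).subtype.restrictScalars k).rTensor H)
      ((f.toLin.restrictScalars k).rTensor H) := by
    apply Module.Flat.rTensor_exact
    intro y
    simp
  refine (this _).1 ?_
  rw [← f.colin, x.2, map_zero]

theorem ker_inj (W : Submodule H M) :
    Function.Injective ((W.subtype.restrictScalars k).rTensor H) :=
  Module.Flat.rTensor_preserves_injective_linearMap _ W.injective_subtype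

/-- The coaction on the kernel. -/
def kerCoact : LinearMap.ker f.toLin →ₗ[k] LinearMap.ker f.toLin ⊗[k] H :=
  (LinearEquiv.ofInjective _ (ker_inj (LinearMap.ker f.toLin))).symm.toLinearMap ∘ₗ
    LinearMap.codRestrict _ (M.coact ∘ₗ (LinearMap.ker f.toLin).subtype.restrictScalars k)
      (ker_coact f)

theorem kerCoact_spec (x : LinearMap.ker f.toLin) : M.coact x =
    ((LinearMap.ker f.toLin).subtype.restrictScalars k).rTensor H (kerCoact f x) := by
  have := LinearEquiv.apply_symm_apply
    (LinearEquiv.ofInjective _ (ker_inj (LinearMap.ker f.toLin)))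
    ⟨M.coact x, ker_coact f x⟩
  exact congrArg Subtype.val this.symm

/-- The kernel. -/
def kerObj : YDModule k H :=
  ofInjective (LinearMap.ker f.toLin) (kerCoact f) M (LinearMap.ker f.toLin).subtype
    (Submodule.injective_subtype _) (kerCoact_spec f)

/-- The inclusion of the kernel. -/
def kerι : kerObj f ⟶ M := ⟨(LinearMap.ker f.toLin).subtype, kerCoact_spec f⟩

instance : Mono (kerι f) :=
  (forgetH k H).mono_of_mono_map
    ((ModuleCat.mono_iff_injective _).2 (Submodule.injective_subtype _))

theorem kerι_comp : kerι f ≫ f = 0 := hom_ext fun m => m.2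

/-- Factoring a morphism through an injective one. -/
def liftInj {L : YDModule k H} (i : M ⟶ N) (hi : Function.Injective i.toLin) (g : L ⟶ N)
    (g' : L →ₗ[H] M) (hg : ∀ x, i.toLin (g' x) = g.toLin x) : L ⟶ M :=
  ⟨g', fun m => by
    apply Module.Flat.rTensor_preserves_injective_linearMap (M := H) (i.toLin.restrictScalars k) hi
    rw [← i.colin, hg, g.colin, ← LinearMap.rTensor_comp_apply]
    congr 2
    ext x
    exact (hg x).symm⟩

/-- Factoring a morphism through a surjective one. -/
def descSurj {L : YDModule k H} (p : M ⟶ N) (hp : Function.Surjective p.toLin) (g : M ⟶ L)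
    (g' : N →ₗ[H] L) (hg : ∀ x, g' (p.toLin x) = g.toLin x) : N ⟶ L :=
  ⟨g', fun n => by
    obtain ⟨m, rfl⟩ := hp n
    rw [p.colin, hg, g.colin, ← LinearMap.rTensor_comp_apply]
    congr 2
    ext x
    exact (hg x).symm⟩

instance : HasKernels (YDModule k H) where
  has_limit f := HasLimit.mk
    { cone := KernelFork.ofι (kerι f) (kerι_comp f)
      isLimit := KernelFork.IsLimit.ofι' _ _ fun g hg =>
        ⟨liftInj (kerι f) (Submodule.injective_subtype _) g
          (g.toLin.codRestrict _ fun x => congr(Hom.toLin $hg x)) fun _ => rfl,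
          hom_ext fun _ => rfl⟩ }

/-- The coaction on the cokernel. -/
def cokerCoact : (N ⧸ LinearMap.range f.toLin) →ₗ[k] (N ⧸ LinearMap.range f.toLin) ⊗[k] H :=
  Submodule.liftQ ((LinearMap.range f.toLin).restrictScalars k)
    (((LinearMap.range f.toLin).mkQ.restrictScalars k).rTensor H ∘ₗ N.coact) (by
      rintro _ ⟨x, rfl⟩
      rw [LinearMap.mem_ker, LinearMap.comp_apply, f.colin, ← LinearMap.rTensor_comp_apply]
      have : (LinearMap.range f.toLin).mkQ.restrictScalars k ∘ₗ f.toLin.restrictScalars k = 0 := by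
        ext x
        simp
      rw [this]; simp) ∘ₗ
  (Submodule.Quotient.restrictScalarsEquiv k (LinearMap.range f.toLin)).symm.toLinearMap

theorem cokerCoact_spec (x : N) : cokerCoact f ((LinearMap.range f.toLin).mkQ x) =
    ((LinearMap.range f.toLin).mkQ.restrictScalars k).rTensor H (N.coact x) := rfl

/-- The cokernel. -/
def cokerObj : YDModule k H :=
  ofImages (N ⧸ LinearMap.range f.toLin) (cokerCoact f) N N (LinearMap.range f.toLin).mkQ
    (LinearMap.range f.toLin).mkQ
    (fun x => by
      obtain ⟨y, rfl⟩ := Submodule.mkQ_surjective _ x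
      exact ⟨y, 0, by simp⟩) (cokerCoact_spec f) (cokerCoact_spec f)

/-- The projection to the cokernel. -/
def cokerπ : N ⟶ cokerObj f := ⟨(LinearMap.range f.toLin).mkQ, cokerCoact_spec f⟩

theorem cokerπ_surjective : Function.Surjective (cokerπ f).toLin :=
  Submodule.mkQ_surjective _

instance : Epi (cokerπ f) :=
  (forgetH k H).epi_of_epi_map ((ModuleCat.epi_iff_surjective _).2 (cokerπ_surjective f))

theorem comp_cokerπ : f ≫ cokerπ f = 0 := hom_ext fun m =>
  (Submodule.Quotient.mk_eq_zero _).2 ⟨m, rfl⟩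

instance : HasCokernels (YDModule k H) where
  has_colimit f := HasColimit.mk
    { cocone := CokernelCofork.ofπ (cokerπ f) (comp_cokerπ f)
      isColimit := CokernelCofork.IsColimit.ofπ' _ _ fun g hg =>
        ⟨descSurj (cokerπ f) (cokerπ_surjective f) g
          ((LinearMap.range f.toLin).liftQ g.toLin (by
            rintro _ ⟨x, rfl⟩
            exact congr(Hom.toLin $hg x))) fun _ => rfl,
          hom_ext fun _ => rfl⟩ }

theorem injective_of_mono [Mono f] : Function.Injective f.toLin := by
  have : kerι f = 0 := by
    rw [← cancel_mono f, kerι_comp, zero_comp]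
  rw [← LinearMap.ker_eq_bot, eq_bot_iff]
  intro x hx
  exact congr(Hom.toLin $this ⟨x, hx⟩)

theorem surjective_of_epi [Epi f] : Function.Surjective f.toLin := by
  have : cokerπ f = 0 := by
    rw [← cancel_epi f, comp_cokerπ, comp_zero]
  rw [← LinearMap.range_eq_top, eq_top_iff]
  intro x _
  exact (Submodule.Quotient.mk_eq_zero _).1 congr(Hom.toLin $this x)

end ker

instance : Abelian (YDModule k H) where
  normalMonoOfMono {M N} f _ := ⟨
    { Z := cokerObj f
      g := cokerπ f
      w := comp_cokerπ f
      isLimit := KernelFork.IsLimit.ofι' _ _ fun {L} g hg => by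
        have hi := injective_of_mono f
        have hx : ∀ x, g.toLin x ∈ LinearMap.range f.toLin := fun x =>
          (Submodule.Quotient.mk_eq_zero _).1 congr(Hom.toLin $hg x)
        have hs : ∀ x, f.toLin (((LinearEquiv.ofInjective f.toLin hi).symm.toLinearMap ∘ₗ
            g.toLin.codRestrict _ hx) x) = g.toLin x := fun x =>
          congrArg Subtype.val
            (LinearEquiv.apply_symm_apply (LinearEquiv.ofInjective f.toLin hi) ⟨g.toLin x, hx x⟩)
        exact ⟨liftInj f hi g _ hs, hom_ext hs⟩ }⟩
  normalEpiOfEpi {M N} f _ := ⟨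
    { W := kerObj f
      g := kerι f
      w := kerι_comp f
      isColimit := CokernelCofork.IsColimit.ofπ' _ _ fun {L} g hg => by
        have hp := surjective_of_epi f
        have hk : LinearMap.ker f.toLin ≤ LinearMap.ker g.toLin := fun x hx =>
          congr(Hom.toLin $hg ⟨x, hx⟩)
        have hs : ∀ x, ((LinearMap.ker f.toLin).liftQ g.toLin hk ∘ₗ
            (f.toLin.quotKerEquivOfSurjective hp).symm.toLinearMap) (f.toLin x) = g.toLin x := by
          intro x
          have : (f.toLin.quotKerEquivOfSurjective hp).symm (f.toLin x) =
              Submodule.Quotient.mk x := by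
            rw [LinearEquiv.symm_apply_eq]; rfl
          simp only [LinearMap.comp_apply, LinearEquiv.coe_coe, this]
          rfl
        exact ⟨descSurj f hp g _ hs, hom_ext hs⟩ }⟩

end category

section cofree

variable {X : Type u} [AddCommGroup X] [Module k X] [Module H X] [IsScalarTower k H X]

section base

variable (X' : Type u) [AddCommGroup X'] [Module k X']

/-- The map `x ⊗ a ↦ x ⊗ a₁ ⊗ a₂`. -/
def tensorComul : X' ⊗[k] H →ₗ[k] (X' ⊗[k] H) ⊗[k] H :=
  (TensorProduct.assoc k X' H H).symm.toLinearMap ∘ₗ (Coalgebra.comul (R := k) (A := H)).lTensor X'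

theorem assoc_tensorComul (x : X' ⊗[k] H) : TensorProduct.assoc k X' H H (tensorComul X' x) =
    (Coalgebra.comul (R := k) (A := H)).lTensor X' x :=
  (TensorProduct.assoc k X' H H).apply_symm_apply _

theorem tensorComul_coassoc (x : X' ⊗[k] H) :
    TensorProduct.assoc k (X' ⊗[k] H) H H ((tensorComul X').rTensor H (tensorComul X' x)) =
      (Coalgebra.comul (R := k) (A := H)).lTensor (X' ⊗[k] H) (tensorComul X' x) := by
  induction x with
  | zero => simp
  | add x y hx hy => simp only [map_add, hx, hy]
  | tmul x a =>
    let e : H ⊗[k] (H ⊗[k] H) →ₗ[k] (X' ⊗[k] H) ⊗[k] (H ⊗[k] H) :=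
      (TensorProduct.assoc k X' H (H ⊗[k] H)).symm.toLinearMap ∘ₗ TensorProduct.mk k _ _ x
    have h2 (a : H) : tensorComul X' (x ⊗ₜ[k] a) = (TensorProduct.assoc k X' H H).symm
        (x ⊗ₜ Coalgebra.comul (R := k) a) := rfl
    rw [h2]
    have h3 : ∀ t : H ⊗[k] H, TensorProduct.assoc k (X' ⊗[k] H) H H
        ((tensorComul X').rTensor H ((TensorProduct.assoc k X' H H).symm (x ⊗ₜ t))) =
        e (TensorProduct.assoc k H H H ((Coalgebra.comul (R := k)).rTensor H t)) := by
      intro t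
      induction t with
      | zero => simp
      | add x y hx hy => simp only [map_add, tmul_add, hx, hy]
      | tmul b c =>
        simp only [assoc_symm_tmul, LinearMap.rTensor_tmul, h2]
        generalize Coalgebra.comul (R := k) b = t
        induction t with
        | zero => simp
        | add x y hx hy => simp only [map_add, tmul_add, add_tmul, hx, hy]
        | tmul a b => simp [e]
    have h5 : ∀ t : H ⊗[k] H, (Coalgebra.comul (R := k) (A := H)).lTensor (X' ⊗[k] H)
        ((TensorProduct.assoc k X' H H).symm (x ⊗ₜ t)) =
        e ((Coalgebra.comul (R := k)).lTensor H t) := by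
      intro t
      induction t with
      | zero => simp
      | add x y hx hy => simp only [map_add, tmul_add, hx, hy]
      | tmul b c => simp [e]
    rw [h3, h5, Coalgebra.coassoc_apply]

theorem tensorComul_counit (x : X' ⊗[k] H) :
    TensorProduct.rid k (X' ⊗[k] H) ((Coalgebra.counit (R := k) (A := H)).lTensor (X' ⊗[k] H)
      (tensorComul X' x)) = x := by
  induction x with
  | zero => simp
  | add x y hx hy => simp only [map_add, hx, hy]
  | tmul x a =>
    have h3 : ∀ t : H ⊗[k] H, TensorProduct.rid k (X' ⊗[k] H)
        ((Coalgebra.counit (R := k) (A := H)).lTensor (X' ⊗[k] H)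
          ((TensorProduct.assoc k X' H H).symm (x ⊗ₜ t))) =
        x ⊗ₜ (TensorProduct.rid k H ((Coalgebra.counit (R := k)).lTensor H t)) := by
      intro t
      induction t with
      | zero => simp
      | add x y hx hy => simp only [map_add, tmul_add, hx, hy]
      | tmul b c => simp
    refine (h3 (Coalgebra.comul (R := k) a)).trans ?_
    simp

theorem tensorComul_counit' (x : X' ⊗[k] H) :
    ((TensorProduct.rid k X').toLinearMap ∘ₗ
      (Coalgebra.counit (R := k) (A := H)).lTensor X').rTensor H (tensorComul X' x) = x := by
  induction x with
  | zero => simp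
  | add x y hx hy => simp only [map_add, hx, hy]
  | tmul x a =>
    have h3 : ∀ t : H ⊗[k] H, ((TensorProduct.rid k X').toLinearMap ∘ₗ
          (Coalgebra.counit (R := k) (A := H)).lTensor X').rTensor H
          ((TensorProduct.assoc k X' H H).symm (x ⊗ₜ t)) =
        x ⊗ₜ (TensorProduct.lid k H ((Coalgebra.counit (R := k)).rTensor H t)) := by
      intro t
      induction t with
      | zero => simp
      | add x y hx hy => simp only [map_add, tmul_add, hx, hy]
      | tmul b c => simp [smul_tmul]
    refine (h3 (Coalgebra.comul (R := k) a)).trans ?_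
    simp

end base

variable {Y : Type u} [AddCommGroup Y] [Module k Y] [Module H Y] [IsScalarTower k H Y]
  (e : Y ≃ₗ[k] X ⊗[k] H)

theorem assoc_act_ad (he : ∀ (h : H) (y : Y), e (h • y) = act X H (ad k H h) (e y))
    (t : H ⊗[k] H) (y : Y ⊗[k] H) :
    TensorProduct.assoc k X H H (e.toLinearMap.rTensor H (act Y H t y)) =
      act X (H ⊗[k] H) (Algebra.TensorProduct.assoc k k k H H H
        (Algebra.TensorProduct.map (ad k H) (AlgHom.id k H) t))
        (TensorProduct.assoc k X H H (e.toLinearMap.rTensor H y)) := by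
  induction t with
  | zero => simp
  | add a b ha hb => simp only [map_add, LinearMap.add_apply, ha, hb]
  | tmul a b =>
    induction y with
    | zero => simp
    | add x y hx hy => simp only [map_add, hx, hy]
    | tmul x c =>
      rw [act_tmul, Algebra.TensorProduct.map_tmul, LinearMap.rTensor_tmul, LinearMap.rTensor_tmul]
      simp only [LinearEquiv.coe_coe, he]
      generalize ad k H a = s
      generalize e x = z
      induction s with
      | zero => simp
      | add a b ha hb => simp only [map_add, LinearMap.add_apply, add_tmul, ha, hb]
      | tmul a a' =>
        induction z with
        | zero => simp
        | add x y hx hy => simp only [map_add, add_tmul, hx, hy]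
        | tmul x d => simp

/-- The coaction transported from `tensorComul` along `e`. -/
def cofreeCoact : Y →ₗ[k] Y ⊗[k] H :=
  e.symm.toLinearMap.rTensor H ∘ₗ tensorComul X ∘ₗ e.toLinearMap

theorem cofreeCoact_spec (y : Y) :
    tensorComul X (e y) = e.toLinearMap.rTensor H (cofreeCoact e y) := by
  have h : e.toLinearMap ∘ₗ e.symm.toLinearMap = LinearMap.id := by ext; simp
  simp only [cofreeCoact, LinearMap.comp_apply, ← LinearMap.rTensor_comp_apply, h]
  simp

/-- The cofree Yetter-Drinfeld module `X ⊗ H` on an `H`-module `X`, realized on a module `Y`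
identified with `X ⊗ H` with the action `h (x ⊗ a) = h₂ x ⊗ h₃ a S(h₁)`. -/
def cofreeOf (he : ∀ (h : H) (y : Y), e (h • y) = act X H (ad k H h) (e y))
    : YDModule k H where
  carrier := Y
  coact := cofreeCoact e
  coassoc := by
    ext y
    apply Module.Flat.rTensor_preserves_injective_linearMap (M := H ⊗[k] H)
      e.toLinearMap e.injective
    simp only [LinearMap.comp_apply, LinearEquiv.coe_coe]
    rw [rTensor_assoc (cofreeCoact e) (tensorComul X) e.toLinearMap (cofreeCoact_spec e),
      rTensor_comul, ← cofreeCoact_spec, tensorComul_coassoc]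
  counit := by
    ext y
    apply e.injective
    have := rTensor_counit e.toLinearMap (cofreeCoact e y)
    rw [← cofreeCoact_spec, tensorComul_counit] at this
    exact this
  compat := fun h m => (compat_iff (cofreeCoact e) m).2 (fun h => by
    apply Module.Flat.rTensor_preserves_injective_linearMap (M := H)
      e.toLinearMap e.injective
    apply (TensorProduct.assoc k X H H).injective
    rw [assoc_act_ad e he, ← cofreeCoact_spec, ← cofreeCoact_spec, assoc_tensorComul,
      assoc_tensorComul, he]
    refine (act_map (Bialgebra.comulAlgHom k H) (ad k H h) (e m)).trans ?_
    rw [← AlgHom.comp_apply (Algebra.TensorProduct.map _ _), ← ad_coassoc]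
    rfl) h

/-- The `H`-linear map `x ⊗ a ↦ ε(a) x`. -/
def cofreeCounit (he : ∀ (h : H) (y : Y), e (h • y) = act X H (ad k H h) (e y))
    : Y →ₗ[H] X where
  toFun y := TensorProduct.rid k X ((Coalgebra.counit (R := k) (A := H)).lTensor X (e y))
  map_add' x y := by simp only [map_add]
  map_smul' h y := by
    have h1 := act_map (Bialgebra.counitAlgHom k H) (ad k H h) (e y)
    rw [← AlgHom.comp_apply (Algebra.TensorProduct.map _ _), ad_counit] at h1
    have h2 : ∀ y : X ⊗[k] k, TensorProduct.rid k X
        (act X k (h ⊗ₜ[k] (1 : k)) y) = h • TensorProduct.rid k X y := by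
      intro y
      induction y with
      | zero => simp
      | add x y hx hy => simp only [map_add, smul_add, hx, hy]
      | tmul x c =>
        simp only [act_tmul, one_mul, rid_tmul]
        exact (smul_comm h c x).symm
    rw [he]
    exact (congrArg _ h1).trans (h2 _)

/-- The `H`-linear map `m ↦ g(m₀) ⊗ m₁` induced by an `H`-linear map `g`. -/
def toCofreeLin (he : ∀ (h : H) (y : Y), e (h • y) = act X H (ad k H h) (e y))
    (M : YDModule k H) (g : M →ₗ[H] X) : M →ₗ[H] Y where
  toFun m := e.symm ((g.restrictScalars k).rTensor H (M.coact m))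
  map_add' x y := by simp only [map_add]
  map_smul' h x := by
    rw [coact_smul, rTensor_act, LinearEquiv.symm_apply_eq, RingHom.id_apply, he,
      LinearEquiv.apply_symm_apply]

theorem equiv_toCofreeLin (he : ∀ (h : H) (y : Y), e (h • y) = act X H (ad k H h) (e y))
    (M : YDModule k H) (g : M →ₗ[H] X) (m : M) :
    e (toCofreeLin e he M g m) = (g.restrictScalars k).rTensor H (M.coact m) :=
  e.apply_symm_apply _

theorem toCofreeLin_colin (he : ∀ (h : H) (y : Y), e (h • y) = act X H (ad k H h) (e y))
    (M : YDModule k H) (g : M →ₗ[H] X) (m : M) : cofreeCoact e (toCofreeLin e he M g m) =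
      ((toCofreeLin e he M g).restrictScalars k).rTensor H (M.coact m) := by
  apply Module.Flat.rTensor_preserves_injective_linearMap (M := H)
    e.toLinearMap e.injective
  apply (TensorProduct.assoc k X H H).injective
  rw [← cofreeCoact_spec, assoc_tensorComul, equiv_toCofreeLin, ← rTensor_comul, ← coassoc_apply,
    rTensor_assoc', ← LinearMap.rTensor_comp_apply]
  congr 3
  ext x
  exact (equiv_toCofreeLin e he M g x).symm

/-- The colinear map `m ↦ g(m₀) ⊗ m₁` induced by an `H`-linear map `g`. -/
def toCofree (he : ∀ (h : H) (y : Y), e (h • y) = act X H (ad k H h) (e y))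
    (M : YDModule k H) (g : M →ₗ[H] X) : M ⟶ cofreeOf e he where
  toLin := toCofreeLin e he M g
  colin := toCofreeLin_colin e he M g

theorem toCofree_naturality (he : ∀ (h : H) (y : Y), e (h • y) = act X H (ad k H h) (e y))
    {M M' : YDModule k H} (f : M ⟶ M') (g : M' →ₗ[H] X) :
    toCofree e he M (g ∘ₗ f.toLin) = f ≫ toCofree e he M' g := by
  refine hom_ext fun m => e.injective ?_
  refine (equiv_toCofreeLin e he M _ m).trans ?_
  refine Eq.trans ?_ (equiv_toCofreeLin e he M' g (f.toLin m)).symm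
  rw [f.colin, ← LinearMap.rTensor_comp_apply]
  rfl

theorem cofreeCounit_toCofree (he : ∀ (h : H) (y : Y), e (h • y) = act X H (ad k H h) (e y))
    (M : YDModule k H) (g : M →ₗ[H] X) (m : M) :
    cofreeCounit e he ((toCofree e he M g).toLin m) = g m := by
  refine (congrArg (fun z => TensorProduct.rid k X
    ((Coalgebra.counit (R := k) (A := H)).lTensor X z)) (e.apply_symm_apply _)).trans ?_
  refine (rTensor_counit (g.restrictScalars k) (M.coact m)).symm.trans ?_
  rw [counit_apply]; rfl

theorem rTensor_cofreeCounit (he : ∀ (h : H) (y : Y), e (h • y) = act X H (ad k H h) (e y))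
    (M : YDModule k H) (f : M →ₗ[H] Y) (m : M) :
    ((cofreeCounit e he ∘ₗ f).restrictScalars k).rTensor H (M.coact m) =
      ((TensorProduct.rid k X).toLinearMap ∘ₗ
      (Coalgebra.counit (R := k) (A := H)).lTensor X).rTensor H (e.toLinearMap.rTensor H
        ((f.restrictScalars k).rTensor H (M.coact m))) := by
  rw [← LinearMap.rTensor_comp_apply, ← LinearMap.rTensor_comp_apply]
  rfl

theorem toCofree_cofreeCounit (he : ∀ (h : H) (y : Y), e (h • y) = act X H (ad k H h) (e y))
    (M : YDModule k H) (f : M ⟶ cofreeOf e he) :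
    toCofree e he M (cofreeCounit e he ∘ₗ f.toLin) = f := by
  refine hom_ext fun m => ?_
  apply e.injective
  refine (e.apply_symm_apply _).trans ?_
  refine (rTensor_cofreeCounit e he M f.toLin m).trans ?_
  refine (congrArg (fun z => ((TensorProduct.rid k X).toLinearMap ∘ₗ
      (Coalgebra.counit (R := k) (A := H)).lTensor X).rTensor H (e.toLinearMap.rTensor H z))
      (f.colin m).symm).trans ?_
  refine (congrArg _ (cofreeCoact_spec e _).symm).trans ?_
  exact tensorComul_counit' X _

end cofree

section adjunction

/-- The space `X ⊗ H` with the `H`-action `h (x ⊗ a) = h₂ x ⊗ h₃ a S(h₁)`. -/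
def Ad (k H X : Type u) [Field k] [CommRing H] [HopfAlgebra k H] [AddCommGroup X] [Module k X]
    [Module H X] [IsScalarTower k H X] : Type u := X ⊗[k] H

variable (X : Type u) [AddCommGroup X] [Module k X] [Module H X] [IsScalarTower k H X]

instance : AddCommGroup (Ad k H X) := inferInstanceAs (AddCommGroup (X ⊗[k] H))

instance : Module k (Ad k H X) := inferInstanceAs (Module k (X ⊗[k] H))

instance : Module H (Ad k H X) :=
  Module.compHom (X ⊗[k] H) ((act X H).comp (ad k H)).toRingHom

/-- The identity map. -/
def adEquiv : Ad k H X ≃ₗ[k] X ⊗[k] H := LinearEquiv.refl k (X ⊗[k] H)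

theorem adEquiv_smul (h : H) (x : Ad k H X) :
    adEquiv X (h • x) = act X H (ad k H h) (adEquiv X x) := rfl

instance : IsScalarTower k H (Ad k H X) where
  smul_assoc c h x := (adEquiv X).injective (by
    rw [adEquiv_smul, map_smul, map_smul, map_smul, adEquiv_smul]; rfl)

/-- The functor to `H`-modules has a right adjoint. -/
theorem forgetH_isLeftAdjoint (k H : Type u) [Field k] [CommRing H] [HopfAlgebra k H] :
    (forgetH k H).IsLeftAdjoint := by
  let _ (V : ModuleCat.{u} H) : Module k V := Module.compHom V (algebraMap k H)
  have (V : ModuleCat.{u} H) : IsScalarTower k H V := IsScalarTower.of_algebraMap_smul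
    fun _ _ => rfl
  exact (Adjunction.adjunctionOfEquivRight (F := forgetH k H)
    (G_obj := fun V => cofreeOf (adEquiv (k := k) (H := H) V) (adEquiv_smul V))
    (fun M V =>
      { toFun := fun g => toCofree _ (adEquiv_smul V) M g.hom
        invFun := fun f => ModuleCat.ofHom (cofreeCounit _ (adEquiv_smul V) ∘ₗ f.toLin)
        left_inv := fun g => by ext m; exact cofreeCounit_toCofree _ _ M g.hom m
        right_inv := fun f => toCofree_cofreeCounit _ _ M f }) (by
      intro M M' V f g
      exact toCofree_naturality _ (adEquiv_smul V) f g.hom)).isLeftAdjoint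

instance : (forgetH k H).PreservesMonomorphisms where
  preserves f _ := (ModuleCat.mono_iff_injective _).2 (injective_of_mono f)

instance : EnoughInjectives (YDModule k H) :=
  haveI := forgetH_isLeftAdjoint k H
  EnoughInjectives.of_adjunction (Adjunction.ofIsLeftAdjoint (forgetH k H))

end adjunction

section tensor

variable (M N : YDModule k H)

/-- The `k`-bilinear map `(m ⊗ a, n ⊗ b) ↦ (m ⊗ n) ⊗ b a`. -/
def tensorMul : M ⊗[k] H →ₗ[k] N ⊗[k] H →ₗ[k] (M ⊗[H] N) ⊗[k] H :=
  TensorProduct.map₂ ((TensorProduct.mk H M N).restrictScalars₁₂ k k) (LinearMap.mul k H).flip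

@[simp] theorem tensorMul_tmul (m : M) (a : H) (n : N) (b : H) :
    tensorMul M N (m ⊗ₜ a) (n ⊗ₜ b) = (m ⊗ₜ[H] n) ⊗ₜ[k] (b * a) := rfl

theorem act_tensorMul_left (t : H ⊗[k] H) (x : M ⊗[k] H) (y : N ⊗[k] H) :
    tensorMul M N (act M H t x) y = act (M ⊗[H] N) H t (tensorMul M N x y) := by
  induction t with
  | zero => simp
  | add a b ha hb => simp only [map_add, LinearMap.add_apply, ha, hb]
  | tmul a b =>
    induction x with
    | zero => simp
    | add x y hx hy => simp only [map_add, LinearMap.add_apply, hx, hy]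
    | tmul m c =>
      induction y with
      | zero => simp
      | add x y hx hy => simp only [map_add, hx, hy]
      | tmul n d => simp [smul_tmul', mul_left_comm]

theorem act_tensorMul_right (t : H ⊗[k] H) (x : M ⊗[k] H) (y : N ⊗[k] H) :
    tensorMul M N x (act N H t y) = act (M ⊗[H] N) H t (tensorMul M N x y) := by
  induction t with
  | zero => simp
  | add a b ha hb => simp only [map_add, LinearMap.add_apply, ha, hb]
  | tmul a b =>
    induction x with
    | zero => simp
    | add x y hx hy => simp only [map_add, LinearMap.add_apply, hx, hy]
    | tmul m c =>
      induction y with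
      | zero => simp
      | add x y hx hy => simp only [map_add, hx, hy]
      | tmul n d => simp [mul_assoc]

/-- The `H`-linear map `m ⊗ n ↦ m₀ ⊗ n₀ ⊗ n₁ m₁`. -/
def tensorCoactAd : M ⊗[H] N →ₗ[H] Ad k H (M ⊗[H] N) :=
  TensorProduct.lift (LinearMap.mk₂ H
    (fun m n => (adEquiv (M ⊗[H] N)).symm (tensorMul M N (M.coact m) (N.coact n)))
    (fun _ _ _ => by simp only [map_add, LinearMap.add_apply])
    (fun h m n => (adEquiv _).injective (by
      rw [adEquiv_smul, LinearEquiv.apply_symm_apply, LinearEquiv.apply_symm_apply, coact_smul,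
        act_tensorMul_left]))
    (fun _ _ _ => by simp only [map_add])
    (fun h m n => (adEquiv _).injective (by
      rw [adEquiv_smul, LinearEquiv.apply_symm_apply, LinearEquiv.apply_symm_apply, coact_smul,
        act_tensorMul_right])))

/-- The coaction `m ⊗ n ↦ m₀ ⊗ n₀ ⊗ n₁ m₁` on the tensor product over `H`. -/
def tensorCoact : M ⊗[H] N →ₗ[k] (M ⊗[H] N) ⊗[k] H :=
  (adEquiv (M ⊗[H] N)).toLinearMap ∘ₗ (tensorCoactAd M N).restrictScalars k

theorem tensorCoact_tmul (m : M) (n : N) :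
    tensorCoact M N (m ⊗ₜ n) = tensorMul M N (M.coact m) (N.coact n) := rfl

theorem tensorCoact_smul (h : H) (x : M ⊗[H] N) :
    tensorCoact M N (h • x) = act (M ⊗[H] N) H (ad k H h) (tensorCoact M N x) := by
  refine (congrArg (adEquiv (M ⊗[H] N)) ((tensorCoactAd M N).map_smul h x)).trans ?_
  exact adEquiv_smul _ _ _

/-- The `k`-bilinear map `(m ⊗ a, n ⊗ b) ↦ (m ⊗ n) ⊗ b a` for `a`, `b` in `H ⊗ H`. -/
def tensorMul₂ : M ⊗[k] (H ⊗[k] H) →ₗ[k] N ⊗[k] (H ⊗[k] H) →ₗ[k]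
    (M ⊗[H] N) ⊗[k] (H ⊗[k] H) :=
  TensorProduct.map₂ ((TensorProduct.mk H M N).restrictScalars₁₂ k k)
    (LinearMap.mul k (H ⊗[k] H)).flip

theorem assoc_tensorCoact (x : M ⊗[k] H) (y : N ⊗[k] H) :
    TensorProduct.assoc k (M ⊗[H] N) H H ((tensorCoact M N).rTensor H (tensorMul M N x y)) =
      tensorMul₂ M N (TensorProduct.assoc k M H H (M.coact.rTensor H x))
        (TensorProduct.assoc k N H H (N.coact.rTensor H y)) := by
  induction x with
  | zero => simp
  | add x y hx hy => simp only [map_add, LinearMap.add_apply, hx, hy]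
  | tmul m c =>
    induction y with
    | zero => simp
    | add x y hx hy => simp only [map_add, hx, hy]
    | tmul n d =>
      simp only [tensorMul_tmul, LinearMap.rTensor_tmul, tensorCoact_tmul]
      generalize M.coact m = x
      generalize N.coact n = y
      induction x with
      | zero => simp
      | add x y hx hy => simp only [map_add, add_tmul, LinearMap.add_apply, hx, hy]
      | tmul m a =>
        induction y with
        | zero => simp
        | add x y hx hy => simp only [map_add, add_tmul, hx, hy]
        | tmul n b => simp [tensorMul₂, mul_comm b a, mul_comm d c]

theorem comul_tensorMul (x : M ⊗[k] H) (y : N ⊗[k] H) :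
    (Coalgebra.comul (R := k) (A := H)).lTensor (M ⊗[H] N) (tensorMul M N x y) =
      tensorMul₂ M N ((Coalgebra.comul (R := k) (A := H)).lTensor M x)
        ((Coalgebra.comul (R := k) (A := H)).lTensor N y) := by
  induction x with
  | zero => simp
  | add x y hx hy => simp only [map_add, LinearMap.add_apply, hx, hy]
  | tmul m c =>
    induction y with
    | zero => simp
    | add x y hx hy => simp only [map_add, hx, hy]
    | tmul n d => simp [tensorMul₂, mul_comm]

theorem counit_tensorMul (x : M ⊗[k] H) (y : N ⊗[k] H) :
    TensorProduct.rid k (M ⊗[H] N)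
      ((Coalgebra.counit (R := k) (A := H)).lTensor (M ⊗[H] N) (tensorMul M N x y)) =
      TensorProduct.rid k M ((Coalgebra.counit (R := k) (A := H)).lTensor M x) ⊗ₜ[H]
      TensorProduct.rid k N ((Coalgebra.counit (R := k) (A := H)).lTensor N y) := by
  induction x with
  | zero => simp
  | add x y hx hy => simp only [map_add, add_tmul, LinearMap.add_apply, hx, hy]
  | tmul m c =>
    induction y with
    | zero => simp
    | add x y hx hy => simp only [map_add, tmul_add, hx, hy]
    | tmul n d =>
      simp only [tensorMul_tmul, LinearMap.lTensor_tmul, Bialgebra.counit_mul, rid_tmul]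
      rw [mul_smul, tmul_smul, smul_tmul']

/-- The tensor product over `H` of Yetter-Drinfeld modules, with the coaction
`m ⊗ n ↦ m₀ ⊗ n₀ ⊗ n₁ m₁`. -/
def tensor : YDModule k H where
  carrier := M ⊗[H] N
  coact := tensorCoact M N
  coassoc := by
    ext x
    simp only [LinearMap.comp_apply, LinearEquiv.coe_coe]
    induction x with
    | zero => simp
    | add x y hx hy => simp only [map_add, hx, hy]
    | tmul m n =>
      rw [tensorCoact_tmul, assoc_tensorCoact, comul_tensorMul, coassoc_apply, coassoc_apply]
  counit := by
    ext x
    simp only [LinearMap.comp_apply, LinearEquiv.coe_coe, LinearMap.id_apply]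
    induction x with
    | zero => simp
    | add x y hx hy => simp only [map_add, hx, hy]
    | tmul m n =>
      rw [tensorCoact_tmul, counit_tensorMul, counit_apply, counit_apply]
  compat := fun h x => (compat_iff (tensorCoact M N) x).2 (fun h => tensorCoact_smul M N h x) h

end tensor

section internalHom

section evalTensor

variable (X Y : Type u) [AddCommGroup X] [Module H X]
  [AddCommGroup Y] [Module k Y] [Module H Y] [IsScalarTower k H Y]
  (Q : Type u) [AddCommGroup Q] [Module k Q]

/-- The canonical map `Hom_H(X, Y) ⊗ Q → Hom_H(X, Y ⊗ Q)`, `f ⊗ q ↦ (x ↦ f(x) ⊗ q)`. -/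
def evalTensor : (X →ₗ[H] Y) ⊗[k] Q →ₗ[k] (X →ₗ[H] Y ⊗[k] Q) :=
  TensorProduct.lift (LinearMap.mk₂ k
    (fun f q => (TensorProduct.AlgebraTensorModule.mk k H Y Q).flip q ∘ₗ f)
    (fun f g q => by ext x; simp [add_tmul]) (fun c f q => by ext x; simp [smul_tmul'])
    (fun f q r => by ext x; simp) (fun c f q => by ext x; simp))

variable {X Y Q}

@[simp] theorem evalTensor_tmul (f : X →ₗ[H] Y) (q : Q) (x : X) :
    evalTensor (k := k) X Y Q (f ⊗ₜ q) x = f x ⊗ₜ q := rfl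

theorem evalTensor_bijective [Module.Finite H X] [Module.Projective H X] :
    Function.Bijective (evalTensor (k := k) (H := H) X Y Q) := by
  obtain ⟨n, f, g, _, _, hfg⟩ := Module.Finite.exists_comp_eq_id_of_projective H X
  let φ (i : Fin n) : X →ₗ[H] H := LinearMap.proj i ∘ₗ g
  let v (i : Fin n) : X := f (fun j => if i = j then 1 else 0)
  have hv (x : X) : x = ∑ i, φ i x • v i := by
    conv_lhs => rw [← LinearMap.id_apply (R := H) x, ← hfg]
    exact LinearMap.pi_apply_eq_sum_univ f (g x)
  let c (i : Fin n) : Y →ₗ[k] (X →ₗ[H] Y) :=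
    { toFun := fun y => (φ i).smulRight y
      map_add' := fun y z => by ext x; simp
      map_smul' := fun a y => by ext x; exact smul_comm _ _ _ }
  have hc (i : Fin n) (z : Y ⊗[k] Q) (x : X) :
      evalTensor X Y Q ((c i).rTensor Q z) x = φ i x • z := by
    induction z with
    | zero => simp
    | add a b ha hb => simp only [map_add, LinearMap.add_apply, smul_add, ha, hb]
    | tmul y q => simp [c, smul_tmul']
  rw [Function.bijective_iff_has_inverse]
  refine ⟨fun g => ∑ i, (c i).rTensor Q (g (v i)), fun t => ?_, fun g => ?_⟩
  · induction t with
    | zero => simp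
    | add a b ha hb =>
      simp only [map_add, LinearMap.add_apply, Finset.sum_add_distrib] at ha hb ⊢
      rw [ha, hb]
    | tmul f q =>
      simp only [evalTensor_tmul, LinearMap.rTensor_tmul, ← sum_tmul]
      refine congrArg (· ⊗ₜ[k] q) ?_
      ext x
      conv_rhs => rw [hv x]
      simp [c]
  · ext x
    conv_rhs => rw [hv x]
    simp [hc]

end evalTensor

variable (N P : YDModule k H)

/-- For `f : N → P` the map `n ⊗ a ↦ f(n)₀ ⊗ f(n)₁ S(a)`. -/
def coactAntipode (f : N →ₗ[k] P) : N ⊗[k] H →ₗ[k] P ⊗[k] H :=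
  TensorProduct.lift ((LinearMap.lTensorHom P ∘ₗ (LinearMap.mul k H).flip ∘ₗ
    HopfAlgebra.antipode k).flip ∘ₗ P.coact ∘ₗ f)

theorem coactAntipode_tmul (f : N →ₗ[k] P) (n : N) (a : H) :
    coactAntipode N P f (n ⊗ₜ a) =
      ((LinearMap.mul k H).flip (HopfAlgebra.antipode k a)).lTensor P (P.coact (f n)) := rfl

theorem lTensor_mul_act (P : YDModule k H) (a : H) (z : P ⊗[k] H) :
    ((LinearMap.mul k H).flip a).lTensor P z = act P H ((1 : H) ⊗ₜ[k] a) z := by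
  induction z with
  | zero => simp
  | add x y hx hy => simp only [map_add, hx, hy]
  | tmul p b => simp

theorem coactAntipode_act (f : N →ₗ[H] P) (t : H ⊗[k] H) (x : N ⊗[k] H) :
    coactAntipode N P (f.restrictScalars k) (act N H t x) =
      act P H (unad k H t) (coactAntipode N P (f.restrictScalars k) x) := by
  induction t with
  | zero => simp
  | add a b ha hb => simp only [map_add, LinearMap.add_apply, ha, hb]
  | tmul a b =>
    induction x with
    | zero => simp
    | add x y hx hy => simp only [map_add, hx, hy]
    | tmul n c =>
      rw [act_tmul, coactAntipode_tmul, coactAntipode_tmul, lTensor_mul_act, lTensor_mul_act,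
        LinearMap.coe_restrictScalars,
        map_smul, coact_smul, HopfAlgebra.antipode_mul_distrib]
      simp only [← Module.End.mul_apply, ← map_mul]
      congr 2
      simp only [unad, Algebra.TensorProduct.lift_tmul, AlgHom.comp_apply,
        Algebra.TensorProduct.includeRight_apply, HopfAlgebra.antipodeAlgHom_apply]
      rw [mul_comm, mul_assoc, Algebra.TensorProduct.tmul_mul_tmul, mul_one]

/-- The map `f ↦ (n ↦ f(n₀)₀ ⊗ f(n₀)₁ S(n₁))` on `H`-linear maps. -/
def homCoactAux : (N →ₗ[H] P) →ₗ[k] (N →ₗ[H] P ⊗[k] H) where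
  toFun f :=
    { toFun := fun n => coactAntipode N P (f.restrictScalars k) (N.coact n)
      map_add' := fun n n' => by simp only [map_add]
      map_smul' := fun h n => by
        rw [coact_smul, coactAntipode_act, unad_ad, RingHom.id_apply]
        generalize coactAntipode N P (f.restrictScalars k) (N.coact n) = z
        induction z with
        | zero => simp
        | add x y hx hy => simp only [map_add, smul_add, hx, hy]
        | tmul p b => simp [smul_tmul'] }
  map_add' f g := by
    ext n
    have : coactAntipode N P ((f + g).restrictScalars k) =
        coactAntipode N P (f.restrictScalars k) + coactAntipode N P (g.restrictScalars k) := by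
      ext n a; simp [coactAntipode]
    exact congr($this (N.coact n))
  map_smul' c f := by
    ext n
    have : coactAntipode N P ((c • f).restrictScalars k) =
        c • coactAntipode N P (f.restrictScalars k) := by
      ext n a; simp [coactAntipode]
    exact congr($this (N.coact n))

/-- For `f : N → P` the map `n ⊗ a ⊗ b ↦ f(n)₀ ⊗ f(n)₁ S(b) ⊗ f(n)₂ S(a)`. -/
def coactAntipode₂ (f : N →ₗ[k] P) : N ⊗[k] (H ⊗[k] H) →ₗ[k] P ⊗[k] (H ⊗[k] H) :=
  TensorProduct.lift ((LinearMap.lTensorHom P ∘ₗ (LinearMap.mul k (H ⊗[k] H)).flip ∘ₗ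
    (TensorProduct.comm k H H).toLinearMap ∘ₗ
    TensorProduct.map (HopfAlgebra.antipode k) (HopfAlgebra.antipode k)).flip ∘ₗ
    (Coalgebra.comul (R := k) (A := H)).lTensor P ∘ₗ P.coact ∘ₗ f)

theorem coactAntipode₂_tmul (f : N →ₗ[k] P) (n : N) (t : H ⊗[k] H) :
    coactAntipode₂ N P f (n ⊗ₜ t) = ((LinearMap.mul k (H ⊗[k] H)).flip
      (TensorProduct.comm k H H (TensorProduct.map (HopfAlgebra.antipode k)
        (HopfAlgebra.antipode k) t))).lTensor P
      ((Coalgebra.comul (R := k) (A := H)).lTensor P (P.coact (f n))) := rfl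

/-- The map `n ⊗ a ↦ z(n)₀₀ ⊗ z(n)₀₁ S(a) ⊗ z(n)₁`. -/
def coactAntipode₃ (z : N →ₗ[k] P ⊗[k] H) : N ⊗[k] H →ₗ[k] (P ⊗[k] H) ⊗[k] H :=
  TensorProduct.lift ((LinearMap.rTensorHom H ∘ₗ LinearMap.lcomp k _ P.coact ∘ₗ
    LinearMap.lTensorHom P ∘ₗ (LinearMap.mul k H).flip ∘ₗ HopfAlgebra.antipode k).flip ∘ₗ z)

theorem coactAntipode₃_tmul (z : N →ₗ[k] P ⊗[k] H) (n : N) (a : H) :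
    coactAntipode₃ N P z (n ⊗ₜ a) =
      (((LinearMap.mul k H).flip (HopfAlgebra.antipode k a)).lTensor P ∘ₗ P.coact).rTensor H
        (z n) := rfl

theorem coactAntipode₃_add (z w : N →ₗ[k] P ⊗[k] H) :
    coactAntipode₃ N P (z + w) = coactAntipode₃ N P z + coactAntipode₃ N P w := by
  ext n a
  simp [coactAntipode₃_tmul]

theorem comul_coactAntipode (f : N →ₗ[k] P) (x : N ⊗[k] H) :
    (Coalgebra.comul (R := k) (A := H)).lTensor P (coactAntipode N P f x) =
      coactAntipode₂ N P f ((Coalgebra.comul (R := k) (A := H)).lTensor N x) := by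
  induction x with
  | zero => simp
  | add x y hx hy => simp only [map_add, hx, hy]
  | tmul n a =>
    rw [LinearMap.lTensor_tmul, coactAntipode₂_tmul, coactAntipode_tmul, ← comul_antipode]
    generalize P.coact (f n) = w
    induction w with
    | zero => simp
    | add x y hx hy => simp only [map_add, hx, hy]
    | tmul p c => simp

theorem evalTensor_comul (z : (N →ₗ[H] P) ⊗[k] H) (n : N) :
    evalTensor N P (H ⊗[k] H) ((Coalgebra.comul (R := k) (A := H)).lTensor (N →ₗ[H] P) z) n =
      (Coalgebra.comul (R := k) (A := H)).lTensor P (evalTensor N P H z n) := by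
  induction z with
  | zero => simp
  | add x y hx hy => simp only [map_add, LinearMap.add_apply, hx, hy]
  | tmul g b => simp

variable [Module.Finite H N] [Module.Projective H N]

/-- The coaction on `Hom_H(N, P)`: `f₀ ⊗ f₁` is the element of `Hom_H(N, P) ⊗ H` such that
`f₀(n) ⊗ f₁ = f(n₀)₀ ⊗ f(n₀)₁ S(n₁)` for all `n`. -/
def homCoact : (N →ₗ[H] P) →ₗ[k] (N →ₗ[H] P) ⊗[k] H :=
  (LinearEquiv.ofBijective (evalTensor N P H) evalTensor_bijective).symm.toLinearMap ∘ₗ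
    homCoactAux N P

theorem evalTensor_homCoact (f : N →ₗ[H] P) (n : N) : evalTensor N P H (homCoact N P f) n =
    coactAntipode N P (f.restrictScalars k) (N.coact n) :=
  congr($(LinearEquiv.apply_symm_apply
    (LinearEquiv.ofBijective (evalTensor N P H) evalTensor_bijective) (homCoactAux N P f)) n)

theorem act_homCoact (h : H) (f : N →ₗ[H] P) :
    homCoact N P (h • f) = act (N →ₗ[H] P) H (ad k H h) (homCoact N P f) := by
  apply (evalTensor_bijective (k := k) (H := H) (X := N) (Y := P) (Q := H)).1
  ext n
  have h1 (t : H ⊗[k] H) (z : (N →ₗ[H] P) ⊗[k] H) :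
      evalTensor N P H (act (N →ₗ[H] P) H t z) n = act P H t (evalTensor N P H z n) := by
    induction t with
    | zero => simp
    | add a b ha hb => simp only [map_add, LinearMap.add_apply, ha, hb]
    | tmul a b =>
      induction z with
      | zero => simp
      | add x y hx hy => simp only [map_add, LinearMap.add_apply, hx, hy]
      | tmul g c => simp
  rw [h1, evalTensor_homCoact, evalTensor_homCoact]
  generalize N.coact n = x
  induction x with
  | zero => simp
  | add x y hx hy => simp only [map_add, hx, hy]
  | tmul n a =>
    rw [coactAntipode_tmul, coactAntipode_tmul, lTensor_mul_act, lTensor_mul_act,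
      LinearMap.coe_restrictScalars, LinearMap.smul_apply, coact_smul]
    simp only [← Module.End.mul_apply, ← map_mul]
    rw [mul_comm]
    rfl

theorem counit_homCoact (f : N →ₗ[H] P) : TensorProduct.rid k (N →ₗ[H] P)
    ((Coalgebra.counit (R := k) (A := H)).lTensor (N →ₗ[H] P) (homCoact N P f)) = f := by
  ext n
  have h1 (z : (N →ₗ[H] P) ⊗[k] H) : TensorProduct.rid k (N →ₗ[H] P)
      ((Coalgebra.counit (R := k) (A := H)).lTensor (N →ₗ[H] P) z) n =
      TensorProduct.rid k P ((Coalgebra.counit (R := k) (A := H)).lTensor P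
        (evalTensor N P H z n)) := by
    induction z with
    | zero => simp
    | add x y hx hy => simp only [map_add, LinearMap.add_apply, hx, hy]
    | tmul g c => simp
  have h2 (x : N ⊗[k] H) : TensorProduct.rid k P ((Coalgebra.counit (R := k) (A := H)).lTensor P
      (coactAntipode N P (f.restrictScalars k) x)) =
      f.restrictScalars k (TensorProduct.rid k N
        ((Coalgebra.counit (R := k) (A := H)).lTensor N x)) := by
    induction x with
    | zero => simp
    | add x y hx hy => simp only [map_add, hx, hy]
    | tmul n a =>
      have h3 (z : P ⊗[k] H) : TensorProduct.rid k P ((Coalgebra.counit (R := k) (A := H)).lTensor P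
          (((LinearMap.mul k H).flip (HopfAlgebra.antipode k a)).lTensor P z)) =
          Coalgebra.counit (R := k) a • TensorProduct.rid k P
            ((Coalgebra.counit (R := k) (A := H)).lTensor P z) := by
        induction z with
        | zero => simp
        | add x y hx hy => simp only [map_add, smul_add, hx, hy]
        | tmul p b =>
          simp only [LinearMap.lTensor_tmul, LinearMap.flip_apply, LinearMap.mul_apply', rid_tmul,
            Bialgebra.counit_mul, HopfAlgebra.counit_antipode]
          rw [mul_comm, mul_smul]
      rw [coactAntipode_tmul, h3, counit_apply, LinearMap.lTensor_tmul, rid_tmul, map_smul]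
  rw [h1, evalTensor_homCoact, h2, counit_apply]
  rfl

theorem evalTensor_assoc (z : (N →ₗ[H] P) ⊗[k] H) (n : N) :
    evalTensor N P (H ⊗[k] H)
      (TensorProduct.assoc k (N →ₗ[H] P) H H ((homCoact N P).rTensor H z)) n =
    TensorProduct.assoc k P H H
      (coactAntipode₃ N P ((evalTensor N P H z).restrictScalars k) (N.coact n)) := by
  induction z with
  | zero =>
    have : coactAntipode₃ N P 0 = 0 := by ext n a; simp [coactAntipode₃_tmul]
    simp [this]
  | add x y hx hy =>
    simp only [map_add, LinearMap.add_apply, LinearMap.restrictScalars_add, coactAntipode₃_add,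
      hx, hy]
  | tmul g b =>
    have h1 (w : (N →ₗ[H] P) ⊗[k] H) : evalTensor N P (H ⊗[k] H)
        (TensorProduct.assoc k (N →ₗ[H] P) H H (w ⊗ₜ b)) n =
        TensorProduct.assoc k P H H (evalTensor N P H w n ⊗ₜ b) := by
      induction w with
      | zero => simp
      | add x y hx hy => simp only [map_add, add_tmul, LinearMap.add_apply, hx, hy]
      | tmul g c => simp
    rw [LinearMap.rTensor_tmul, h1, evalTensor_homCoact]
    congr 1
    generalize N.coact n = x
    induction x with
    | zero => simp
    | add x y hx hy => simp only [map_add, add_tmul, hx, hy]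
    | tmul n a => rfl

theorem assoc_coactAntipode₃ (f : N →ₗ[H] P) (x : N ⊗[k] H) :
    TensorProduct.assoc k P H H
      (coactAntipode₃ N P ((evalTensor N P H (homCoact N P f)).restrictScalars k) x) =
    coactAntipode₂ N P (f.restrictScalars k)
      (TensorProduct.assoc k N H H (N.coact.rTensor H x)) := by
  induction x with
  | zero => simp
  | add x y hx hy => simp only [map_add, hx, hy]
  | tmul n a =>
    rw [coactAntipode₃_tmul, LinearMap.coe_restrictScalars, evalTensor_homCoact,
      LinearMap.rTensor_tmul]
    generalize N.coact n = y
    induction y with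
    | zero => simp
    | add x y hx hy => simp only [map_add, add_tmul, hx, hy]
    | tmul n b =>
      rw [TensorProduct.assoc_tmul, coactAntipode_tmul, coactAntipode₂_tmul, ← coassoc_apply,
        TensorProduct.map_tmul, TensorProduct.comm_tmul]
      generalize P.coact (f.restrictScalars k n) = w
      induction w with
      | zero => simp
      | add x y hx hy => simp only [map_add, hx, hy]
      | tmul p c =>
        simp only [LinearMap.lTensor_tmul, LinearMap.rTensor_tmul, LinearMap.comp_apply]
        generalize P.coact p = v
        induction v with
        | zero => simp
        | add x y hx hy => simp only [map_add, add_tmul, hx, hy]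
        | tmul q d => simp

/-- The Yetter-Drinfeld module `Hom_H(N, P)` for `N` finitely generated projective over `H`, with
`H`-action `(h f)(n) = h f(n)` and coaction `homCoact`. -/
def internalHom : YDModule k H where
  carrier := N →ₗ[H] P
  coact := homCoact N P
  coassoc := by
    refine LinearMap.ext fun f => ?_
    apply (evalTensor_bijective (k := k) (H := H) (X := N) (Y := P) (Q := H ⊗[k] H)).1
    ext n
    simp only [LinearMap.comp_apply, LinearEquiv.coe_coe]
    rw [evalTensor_assoc, assoc_coactAntipode₃, coassoc_apply, evalTensor_comul,
      evalTensor_homCoact, comul_coactAntipode]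
  counit := LinearMap.ext fun f => counit_homCoact N P f
  compat := fun h f => (compat_iff (homCoact N P) f).2 (fun h => act_homCoact N P h f) h

end internalHom

/-- The `i`-th right derived functor of the left exact functor `Hom(M, -)` from Yetter-Drinfeld
modules to `k`-modules, where `Hom(M, P)` consists of the `H`-linear `H`-colinear maps. -/
def extFunctor (M : YDModule k H) (i : ℕ) : YDModule k H ⥤ ModuleCat.{u} k :=
  ((linearCoyoneda k (YDModule k H)).obj (Opposite.op M)).rightDerived i

end

end YDModule

/-! The functor `- ⊗_H N` on Yetter–Drinfeld modules is left adjoint to `Hom_H(N, -)`, and the usual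
tensor-hom argument then passes to derived functors. Finitely generated projective modules make both
ends work: `N` is flat, so `- ⊗_H N` preserves monomorphisms and its right adjoint preserves
injectives; `N` is projective, so `Hom_H(N, -)` preserves epimorphisms and, being a right adjoint,
kernels, hence is exact. An injective resolution `I` of `P` is therefore carried to an injective
resolution `Hom_H(N, I)` of `Hom_H(N, P)`. Applying `Hom(M, -)` to it gives, by the adjunction, the
complex `Hom(M ⊗_H N, I)`; the two Ext groups are the cohomology of isomorphic complexes.

The substance lies in the adjunction. Currying is already a bijection on `H`-linear maps, so only
colinearity must be compared (`lift_colinear_iff`). For a bilinear `F`, put `φ_m(n) = F(m)(n)₀ ⊗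
F(m)(n)₁` and `ψ_m(n) = F(m₀)(n) ⊗ m₁`. Colinearity on `M ⊗_H N` says `φ_m(n) = ψ_m(n₀) n₁`;
colinearity into `Hom_H(N, P)` says `φ_m(n₀) S(n₁) = ψ_m(n)`, where `H` multiplies the second tensor
factor. These are equivalent since the identity and `S` are convolution inverse to each other. The
operation `φ ↦ φ(n₀) c(n₁)` is `twist` composed with the coaction, and `twist_twist` states the
inversion. -/

namespace YDModule

variable {k H : Type u} [Field k] [CommRing H] [HopfAlgebra k H]

/-! ### Convolution along a coaction -/

section twist

variable (P : YDModule k H) {X : Type*} [AddCommGroup X] [Module k X]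
  {B : Type*} [AddCommGroup B] [Module k B]

/-- The map `x ⊗ b ↦ φ(x) c(b)`, where `H` acts on the second factor of `P ⊗ H`. -/
noncomputable def twist (c : B →ₗ[k] H) (φ : X →ₗ[k] P ⊗[k] H) : X ⊗[k] B →ₗ[k] P ⊗[k] H :=
  TensorProduct.lift
    (((((act P H).comp (Algebra.TensorProduct.includeRight : H →ₐ[k] H ⊗[k] H)).toLinearMap) ∘ₗ c).flip ∘ₗ φ)

@[simp] theorem twist_tmul (c : B →ₗ[k] H) (φ : X →ₗ[k] P ⊗[k] H) (x : X) (b : B) :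
    twist P c φ (x ⊗ₜ b) = act P H ((1 : H) ⊗ₜ[k] c b) (φ x) := rfl

/-- Two successive twists involve `φ(x₀) d(x₁) c(a)`, so they depend only on the product of the
values of `d` and `c`. The map `ρ` is arbitrary here; for a coaction, coassociativity then turns
this product into the convolution of `d` and `c`. -/
theorem twist_rTensor (c d : H →ₗ[k] H) (ρ : X →ₗ[k] X ⊗[k] H) (φ : X →ₗ[k] P ⊗[k] H)
    (x : X ⊗[k] H) :
    twist P c (twist P d φ ∘ₗ ρ) x = twist P (LinearMap.mul' k H ∘ₗ TensorProduct.map d c) φ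
      (TensorProduct.assoc k X H H (ρ.rTensor H x)) := by
  induction x with
  | zero => simp
  | add x y hx hy => simp only [map_add, hx, hy]
  | tmul x a =>
    rw [twist_tmul, LinearMap.comp_apply, LinearMap.rTensor_tmul]
    generalize ρ x = y
    induction y with
    | zero => simp
    | add x y hx hy => simp only [map_add, add_tmul, hx, hy]
    | tmul x b =>
      -- The outer twist multiplies on the left and yields `c(a) d(b)`; commutativity of `H`
      -- restores the order of `d ⊗ c`.
      rw [TensorProduct.assoc_tmul, twist_tmul, twist_tmul, ← Module.End.mul_apply, ← map_mul,
        Algebra.TensorProduct.tmul_mul_tmul, one_mul, mul_comm]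
      rfl

theorem twist_lTensor {B' : Type*} [AddCommGroup B'] [Module k B'] (g : B' →ₗ[k] B)
    (c : B →ₗ[k] H) (φ : X →ₗ[k] P ⊗[k] H) (x : X ⊗[k] B') :
    twist P c φ (g.lTensor X x) = twist P (c ∘ₗ g) φ x := by
  induction x with
  | zero => simp
  | add x y hx hy => simp only [map_add, hx, hy]
  | tmul x a => simp

/-- The unit of convolution takes scalar values `ε(a) 1`, which can be moved inside `φ`. Evaluated
on a coaction, this makes twisting by the unit the identity. -/
theorem twist_counit (φ : X →ₗ[k] P ⊗[k] H) (x : X ⊗[k] H) :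
    twist P (Algebra.linearMap k H ∘ₗ Coalgebra.counit (R := k) (A := H)) φ x =
      φ (TensorProduct.rid k X ((Coalgebra.counit (R := k) (A := H)).lTensor X x)) := by
  induction x with
  | zero => simp
  | add x y hx hy => simp only [map_add, hx, hy]
  | tmul x a =>
    rw [twist_tmul, LinearMap.comp_apply, Algebra.linearMap_apply, Algebra.algebraMap_eq_smul_one,
      tmul_smul, map_smul, ← Algebra.TensorProduct.one_def]
    simp

/-- Twisting along the coaction by convolution inverse maps gives inverse operations. -/
theorem twist_twist (N : YDModule k H) {c d : H →ₗ[k] H}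
    (h : LinearMap.mul' k H ∘ₗ TensorProduct.map d c ∘ₗ Coalgebra.comul (R := k) (A := H) =
      Algebra.linearMap k H ∘ₗ Coalgebra.counit (R := k) (A := H))
    (φ : N →ₗ[k] P ⊗[k] H) (n : N) :
    twist P c (twist P d φ ∘ₗ N.coact) (N.coact n) = φ n := by
  -- Coassociativity moves the second coaction to a comultiplication on `H`, where `h` collapses the
  -- convolution product to the unit.
  rw [twist_rTensor, coassoc_apply, twist_lTensor, LinearMap.comp_assoc, h, twist_counit,
    counit_apply]

end twist

/-! ### Colinearity under currying -/

section curry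

variable {M N P : YDModule k H}

/-- This puts the coaction of `Hom_H(N, P)` in convolution form, with `S` as the twisting map. -/
theorem coactAntipode_eq_twist (f : N →ₗ[k] P) (x : N ⊗[k] H) :
    coactAntipode N P f x = twist P (HopfAlgebra.antipode k) (P.coact ∘ₗ f) x := by
  induction x with
  | zero => simp
  | add x y hx hy => simp only [map_add, hx, hy]
  | tmul n a => rw [coactAntipode_tmul, lTensor_mul_act, twist_tmul, LinearMap.comp_apply]

/-- On pure tensors `m ⊗ a` and `n ⊗ b` both sides are `F(m)(n) ⊗ b a`. With coactions inserted, the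
right side of the colinearity condition on `M ⊗_H N` becomes a twist by the identity map; the order
`n₁ m₁` in the coaction matches the left multiplication in `twist`. -/
theorem rTensor_lift_tensorMul (F : M →ₗ[H] N →ₗ[H] P) (y : M ⊗[k] H) (z : N ⊗[k] H) :
    ((TensorProduct.lift F).restrictScalars k).rTensor H (tensorMul M N y z) =
      twist P LinearMap.id ((evalTensor N P H
        ((F.restrictScalars k).rTensor H y)).restrictScalars k) z := by
  induction z with
  | zero => simp
  | add z w hz hw => simp only [map_add, hz, hw]
  | tmul n b =>
    rw [twist_tmul]
    induction y with
    | zero => simp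
    | add y w hy hw =>
      simp only [map_add, LinearMap.add_apply, hy, hw, LinearMap.coe_restrictScalars]
    | tmul m a => simp

variable [Module.Finite H N] [Module.Projective H N]

/-- A bilinear map `M × N → P` is colinear on `M ⊗ N` if and only if it is colinear as a map
from `M` to `Hom_H(N, P)`. -/
theorem lift_colinear_iff (F : M →ₗ[H] N →ₗ[H] P) :
    (∀ x, P.coact (TensorProduct.lift F x) =
      ((TensorProduct.lift F).restrictScalars k).rTensor H (tensorCoact M N x)) ↔
    ∀ m, homCoact N P (F m) = (F.restrictScalars k).rTensor H (M.coact m) := by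
  -- For fixed `m`, `φ m` is `n ↦ F(m)(n)₀ ⊗ F(m)(n)₁` and `ψ m` is `n ↦ F(m₀)(n) ⊗ m₁`. Each
  -- colinearity condition expresses one of them as a twist of the other.
  let φ (m : M) : N →ₗ[k] P ⊗[k] H := P.coact ∘ₗ (F m).restrictScalars k
  let ψ (m : M) : N →ₗ[k] P ⊗[k] H :=
    (evalTensor N P H ((F.restrictScalars k).rTensor H (M.coact m))).restrictScalars k
  have hl : (∀ x, P.coact (TensorProduct.lift F x) =
      ((TensorProduct.lift F).restrictScalars k).rTensor H (tensorCoact M N x)) ↔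
      ∀ m, φ m = twist P LinearMap.id (ψ m) ∘ₗ N.coact := by
    constructor
    · intro h m
      ext n
      refine (h (m ⊗ₜ n)).trans ?_
      rw [tensorCoact_tmul, rTensor_lift_tensorMul]
      rfl
    · intro h x
      induction x with
      | zero => simp
      | add x y hx hy => simp only [map_add, hx, hy]
      | tmul m n =>
        rw [tensorCoact_tmul, rTensor_lift_tensorMul]
        exact congr($(h m) n)
  have hr : (∀ m, homCoact N P (F m) = (F.restrictScalars k).rTensor H (M.coact m)) ↔
      ∀ m, twist P (HopfAlgebra.antipode k) (φ m) ∘ₗ N.coact = ψ m := by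
    refine forall_congr' fun m => ?_
    -- An equality in `Hom_H(N, P) ⊗ H` may be tested on elements of `N` because `evalTensor` is
    -- injective, `N` being finitely generated projective.
    rw [← (evalTensor_bijective (k := k) (H := H) (X := N) (Y := P) (Q := H)).1.eq_iff,
      LinearMap.ext_iff, LinearMap.ext_iff]
    refine forall_congr' fun n => ?_
    rw [evalTensor_homCoact, coactAntipode_eq_twist]
    rfl
  rw [hl, hr]
  refine forall_congr' fun m => ⟨fun h => ?_, fun h => ?_⟩
  -- Here the identity is applied before `S`, so the relation needed is `h₁ S(h₂) = ε(h)`; the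
  -- converse below uses `S(h₁) h₂ = ε(h)`.
  · rw [h]
    exact LinearMap.ext fun n => twist_twist P N
      (by simpa [LinearMap.lTensor_def] using HopfAlgebra.mul_antipode_lTensor_comul) (ψ m) n
  · rw [← h]
    exact LinearMap.ext fun n => (twist_twist P N
      (by simpa [LinearMap.rTensor_def] using HopfAlgebra.mul_antipode_rTensor_comul) (φ m) n).symm

variable (M N P) in
/-- The isomorphism `Hom(M ⊗ N, P) ≃ Hom(M, Hom_H(N, P))`. -/
noncomputable def curryEquiv : (tensor M N ⟶ P) ≃ₗ[k] (M ⟶ internalHom N P) where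
  toFun f := ⟨TensorProduct.curry f.toLin, (lift_colinear_iff _).1 (by
    -- `lift_colinear_iff` speaks of maps of the form `lift F`, so `f` has to be recognized as the
    -- lift of its own currying.
    have h : TensorProduct.lift (TensorProduct.curry f.toLin) = f.toLin := lift_mk_compr₂ _
    rw [h]
    exact f.colin)⟩
  invFun g := ⟨TensorProduct.lift g.toLin, (lift_colinear_iff _).2 g.colin⟩
  map_add' _ _ := rfl
  map_smul' _ _ := rfl
  left_inv f := Hom.ext (lift_mk_compr₂ _)
  right_inv g := hom_ext fun m => LinearMap.ext fun n => rfl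

end curry

/-! ### The adjunction and its exactness properties -/

section tensorFunctor

variable (N : YDModule k H)

theorem rTensor_tensorMul {M M' : YDModule k H} (f : M →ₗ[H] M') (x : M ⊗[k] H) (y : N ⊗[k] H) :
    ((f.rTensor N).restrictScalars k).rTensor H (tensorMul M N x y) =
      tensorMul M' N ((f.restrictScalars k).rTensor H x) y := by
  induction x with
  | zero => simp
  | add x y hx hy => simp only [map_add, LinearMap.add_apply, hx, hy]
  | tmul m a =>
    induction y with
    | zero => simp
    | add x y hx hy => simp only [map_add, hx, hy]
    | tmul n b => simp

/-- The functor `M ↦ M ⊗ N`. -/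
noncomputable def tensorFunctor : YDModule k H ⥤ YDModule k H where
  obj M := tensor M N
  map {M M'} f := ⟨f.toLin.rTensor N, fun x => by
    change tensorCoact M' N (f.toLin.rTensor N x) =
      ((f.toLin.rTensor N).restrictScalars k).rTensor H (tensorCoact M N x)
    induction x using TensorProduct.induction_on with
    | zero => simp
    | add x y hx hy => simp only [map_add, hx, hy]
    | tmul m n =>
      rw [tensorCoact_tmul, rTensor_tensorMul, LinearMap.rTensor_tmul, tensorCoact_tmul, f.colin]⟩
  map_id M := Hom.ext (LinearMap.rTensor_id N M)
  map_comp f g := Hom.ext (LinearMap.rTensor_comp N g.toLin f.toLin)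

instance : (tensorFunctor N).Additive where
  map_add {_ _ f g} := Hom.ext (LinearMap.rTensor_add N f.toLin g.toLin)

/-- Monomorphisms of Yetter–Drinfeld modules are injective, and the faithful functor to `H`-modules
reflects monomorphisms, so flatness over `H` suffices. This is what makes the right adjoint preserve
injectives. -/
instance [Module.Flat H N] : (tensorFunctor N).PreservesMonomorphisms where
  preserves f _ := (forgetH k H).mono_of_mono_map ((ModuleCat.mono_iff_injective _).2
    (Module.Flat.rTensor_preserves_injective_linearMap f.toLin (injective_of_mono f)))

variable [Module.Finite H N] [Module.Projective H N]

/-- The functor `P ↦ Hom_H(N, P)`. -/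
noncomputable def internalHomFunctor : YDModule k H ⥤ YDModule k H :=
  Adjunction.rightAdjointOfEquiv (F := tensorFunctor N) (G_obj := fun P => internalHom N P)
    (fun M P => (curryEquiv M N P).toEquiv)
    -- Only naturality of currying in `M` is asked for. The functor's action on morphisms is then
    -- determined by the equivalence, and unfolds to postcomposition.
    (fun _ _ _ _ _ => hom_ext fun _ => LinearMap.ext fun _ => rfl)

/-- The adjunction between `- ⊗ N` and `Hom_H(N, -)`. -/
noncomputable def tensorHomAdjunction : tensorFunctor N ⊣ internalHomFunctor N :=
  Adjunction.adjunctionOfEquivRight _ _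

instance : (internalHomFunctor N).Additive := (tensorHomAdjunction N).right_adjoint_additive

/-- Epimorphisms here are surjective, and a map from the projective `N` lifts through a surjection.
The lift need only be `H`-linear, since elements of `Hom_H(N, P)` are not required to be colinear.
-/
instance : (internalHomFunctor N).PreservesEpimorphisms where
  preserves f _ := (forgetH k H).epi_of_epi_map ((ModuleCat.epi_iff_surjective _).2
    fun (g : N →ₗ[H] _) => Module.projective_lifting_property f.toLin g (surjective_of_epi f))

/-- A right adjoint preserves kernels; together with preservation of epimorphisms this gives
exactness. -/
instance : (internalHomFunctor N).PreservesHomology :=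
  haveI := (tensorHomAdjunction N).rightAdjoint_preservesLimits
  Functor.preservesHomology_of_preservesEpis_and_kernels _

/-- Extending a map into `Hom_H(N, I)` along a monomorphism amounts to extending the adjoint map
into `I` along that monomorphism tensored with `N`, which remains a monomorphism by flatness. -/
instance : (internalHomFunctor N).PreservesInjectiveObjects where
  injective_obj I := (tensorHomAdjunction N).map_injective _ I

/-- The isomorphism `Hom(M, Hom_H(N, P)) ≅ Hom(M ⊗ N, P)`, natural in `P`. -/
noncomputable def homInternalHomIso (M : YDModule k H) :
    internalHomFunctor N ⋙ (linearCoyoneda k (YDModule k H)).obj (Opposite.op M) ≅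
      (linearCoyoneda k (YDModule k H)).obj (Opposite.op (tensor M N)) :=
  NatIso.ofComponents (fun P => (curryEquiv M N P).symm.toModuleIso) fun {P P'} f => by
    refine ModuleCat.hom_ext (LinearMap.ext fun g => ?_)
    -- After currying, the inverse equivalence on one side cancels, and both sides send `m` and `n`
    -- to `f(g(m)(n))`.
    apply (curryEquiv M N P').injective
    refine ((curryEquiv M N P').apply_symm_apply _).trans ?_
    exact hom_ext fun m => LinearMap.ext fun n => rfl

end tensorFunctor

end YDModule

/-! ### Transport of injective resolutions -/

namespace CategoryTheory.Functor

variable {C D : Type*} [Category* C] [Category* D] [Preadditive C] [Preadditive D]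
  [HasZeroObject C] [HasZeroObject D] [CategoryWithHomology D]

/-- An additive functor which preserves homology and injective objects sends an injective
resolution of `Z` to an injective resolution of `F.obj Z`. -/
noncomputable def mapInjectiveResolution (F : C ⥤ D) [F.Additive] [F.PreservesInjectiveObjects]
    [F.PreservesHomology] {Z : C} (I : InjectiveResolution Z) :
    InjectiveResolution (F.obj Z) where
  cocomplex := (F.mapHomologicalComplex _).obj I.cocomplex
  injective n := PreservesInjectiveObjects.injective_obj (I.injective n)
  -- The augmentation must start at `F.obj Z` placed in degree zero, whereas `F` applied to `I.ι`
  -- starts at the image of the single complex on `Z`; the first factor identifies them. It is an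
  -- isomorphism, and the second factor is a quasi-isomorphism because `F` preserves homology.
  ι := (HomologicalComplex.singleMapHomologicalComplex _ _ _).inv.app _ ≫
    (F.mapHomologicalComplex _).map I.ι
  quasiIso := inferInstance

end CategoryTheory.Functor

theorem proposition2p2 {k H : Type u} [Field k] [CommRing H] [HopfAlgebra k H]
    (M N P : YDModule k H) [Module.Finite H N] [Module.Projective H N] (i : ℕ) :
    Nonempty (((YDModule.extFunctor M i).obj (YDModule.internalHom N P)) ≃ₗ[k]
      ((YDModule.extFunctor (YDModule.tensor M N) i).obj P)) := by
  let I := injectiveResolution P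
  -- Both Ext groups are computed from the single resolution `I`: directly for `M ⊗_H N`, and
  -- through its image `J` for `M`.
  let J : InjectiveResolution (YDModule.internalHom N P) :=
    (YDModule.internalHomFunctor N).mapInjectiveResolution I
  -- Naturality in `P` makes the degreewise adjunction isomorphisms commute with the differentials
  -- of `I`. The source of `e` is by definition `Hom(M, -)` applied to the complex of `J`.
  let e := (NatIso.mapHomologicalComplex (YDModule.homInternalHomIso N M) _).app I.cocomplex
  exact ⟨(J.isoRightDerivedObj _ i ≪≫ (HomologicalComplex.homologyFunctor _ _ i).mapIso e ≪≫
    (I.isoRightDerivedObj _ i).symm).toLinearEquiv⟩
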